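/- Let $n\ge 1$ and let $\mathscr M_+(\mathbb R^n)$ be the set of positive locally finite Borel measures on $\mathbb R^n$, with the smallest $\sigma$-algebra making $p\mapsto\int f\,dp$ measurable for every bounded measurable $f:\mathbb R^n\to\mathbb C$ with bounded support. Let $\mu$ be a random measure on $\mathbb R^n$, i.e. a probability measure on $\mathscr M_+(\mathbb R^n)$. Assume that $\mu$ is invariant (for every $x\in\mathbb R^n$ it is preserved by the map sending $p$ to its push-forward under the translation $y\mapsto x+y$), that $\mu$ is locally square-integrable ($\int p(B)^2\,d\mu(p)<\infty$ for every bounded Borel set $B\subset\mathbb R^n$), and that $\mu$ is not the point mass at $c\cdot\mathrm{Leb}$ for any constant $c\ge 0$, where $\mathrm{Leb}$ is Lebesgue measure. For $R>0$ let $B_R$ be the Euclidean ball of radius $R$ centered at the origin, let $$\mathrm{NV}_\mu(R)=\mathrm{Var}_\mu\big(p\mapsto p(B_R)\big)=\int \Big|p(B_R)-\int q(B_R)\,d\mu(q)\Big|^2d\mu(p)$$ be the number variance, and let $\mathrm{Vol}_{n-1}(\partial B_R)=\frac{2\pi^{n/2}}{\Gamma(n/2)}R^{n-1}$. Then $$\limsup_{R\to\infty}\frac{\mathrm{NV}_\mu(R)}{\mathrm{Vol}_{n-1}(\partial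 B_R)}>0,$$ where the limit superior may be $+\infty$. -/

import Mathlib

open MeasureTheory ProbabilityTheory Filter Set
open scoped ENNReal NNReal

/-- The cone of positive locally finite Borel measures on `ℝⁿ`. -/
def LocFinMeasure (n : ℕ) : Type :=
  {p : Measure (EuclideanSpace ℝ (Fin n)) // IsLocallyFiniteMeasure p}

namespace LocFinMeasure

/-- The σ-algebra generated by the evaluations `p ↦ p(B)`, `B` Borel. As `p(B)` is the increasing
limit of `p(B ∩ B_k)`, and bounded measurable functions with bounded support are limits of simple
functions, it is also the smallest σ-algebra for which every linear statistic `p ↦ ∫ f dp`, `f`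
bounded measurable with bounded support, is measurable. -/
instance instMeasurableSpace (n : ℕ) : MeasurableSpace (LocFinMeasure n) :=
  inferInstanceAs (MeasurableSpace
    {p : Measure (EuclideanSpace ℝ (Fin n)) // IsLocallyFiniteMeasure p})

theorem isLocallyFiniteMeasure_map_add {n : ℕ} (x : EuclideanSpace ℝ (Fin n))
    (p : LocFinMeasure n) :
    IsLocallyFiniteMeasure (p.1.map (fun y => x + y)) := by
  have := p.2
  refine ⟨fun z => ?_⟩
  obtain ⟨s, hs, hp⟩ := p.1.finiteAt_nhds (-x + z)
  refine ⟨(fun y => -x + y) ⁻¹' s, (by fun_prop : Continuous fun y => -x + y).continuousAt hs, ?_⟩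
  have e := (MeasurableEquiv.addLeft x).map_apply (μ := p.1) ((fun y => -x + y) ⁻¹' s)
  have h : (MeasurableEquiv.addLeft x) ⁻¹' ((fun y => -x + y) ⁻¹' s) = s := by
    ext y
    simp
  rw [h] at e
  exact lt_of_eq_of_lt e hp

/-- The action of `ℝⁿ` by translation: the push-forward of `p` along `y ↦ x + y`. -/
noncomputable def translate {n : ℕ} (x : EuclideanSpace ℝ (Fin n)) (p : LocFinMeasure n) :
    LocFinMeasure n :=
  ⟨p.1.map (fun y => x + y), isLocallyFiniteMeasure_map_add x p⟩

theorem measurable_translate {n : ℕ} (x : EuclideanSpace ℝ (Fin n)) :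
    Measurable (translate x) :=
  Measurable.subtype_mk
    ((Measure.measurable_map _ (measurable_const_add x)).comp measurable_subtype_coe)

end LocFinMeasure

namespace RandomMeasure

/-- A random measure on `ℝⁿ`, given by its law `μ`, is invariant if its law is preserved by all
translations. -/
def IsInvariant {n : ℕ} (μ : Measure (LocFinMeasure n)) : Prop :=
  ∀ x : EuclideanSpace ℝ (Fin n), μ.map (LocFinMeasure.translate x) = μ

/-- `∫ p(B)² dμ(p) < ∞` for every bounded Borel set `B`. -/
def IsLocallySquareIntegrable {n : ℕ} (μ : Measure (LocFinMeasure n)) : Prop :=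
  ∀ B : Set (EuclideanSpace ℝ (Fin n)), MeasurableSet B → Bornology.IsBounded B →
    ∫⁻ p, (p.1 B) ^ 2 ∂μ < ∞

/-- The number variance: the `μ`-variance of `p ↦ p(B_R)`. -/
noncomputable def numberVariance {n : ℕ} (μ : Measure (LocFinMeasure n)) (R : ℝ) : ℝ :=
  variance (fun p : LocFinMeasure n => p.1.real (Metric.ball 0 R)) μ

/-- `Vol_{n-1}(∂B_R) = R^{n-1} σ_{n-1}(S^{n-1})`, where `σ_{n-1}` is the surface measure on the unit
sphere, normalized by integration in polar coordinates against Lebesgue measure; for `n = 1` it is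
the counting measure on two points. Used for `1 ≤ n` and `0 < R`. -/
noncomputable def sphereVolume (n : ℕ) (R : ℝ) : ℝ :=
  R ^ (n - 1) * (volume : Measure (EuclideanSpace ℝ (Fin n))).toSphere.real univ

/-- The law `μ` is the point mass at a constant multiple `c · Lebesgue` (`c ≥ 0`). -/
def IsDeterministicLebesgue {n : ℕ} (μ : Measure (LocFinMeasure n)) : Prop :=
  ∃ c : ℝ≥0, ∀ᵐ p ∂μ, p.1 = c • (volume : Measure (EuclideanSpace ℝ (Fin n)))

end RandomMeasure

/-! Averaging over `R` with weight `R exp (-bR²) dR` turns the ball autocorrelations `1_{B_R} ⋆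
1_{B_R}` into a positive mixture of Gaussian autocorrelations with parameters `t = b(1 + θ²)/4`
(`lintegral_ball_correlation`). The radial average replaces the two ball constraints by `exp (-b
max(‖z + v‖, ‖z‖)²)`. Centred at the midpoint this is `exp (-b(‖w‖² + |⟨v, w⟩| + ‖v‖²/4))`, and `exp
(-|s|)` is a Cauchy mixture of cosines, which Gaussians integrate exactly.

For an invariant `μ` the second moment of a linear statistic depends only on the autocorrelation of
the test function (`exists_reduced_secondMoment`). Hence the average of the number variance is the
same mixture of variances of Gaussian statistics (`lintegral_gaussianVariance_le`).

If the limsup were not positive, the number variance would be `o(R^(n-1))`, and its average would be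
`o(b^(-(n+1)/2))` as `b → 0`. In the variable `t` the mixture has size `b^(-(n+1)/2) t^((n-3)/2) dt`
on `t > a`, so the Gaussian variance vanishes for almost every `t`
(`lintegral_gaussianVariance_eq_zero`). Gaussian statistics are then almost surely constant at
arbitrarily large `t`. They form an approximate identity, so `p(U) = m vol(U)` almost surely for
open `U` of finite volume, and `p = m · Leb`. -/

/-! ### The exponential `exp (-|a|)` as a Cauchy mixture of cosines. -/

open scoped FourierTransform in
theorem fourier_exp_neg_abs (w : ℝ) :
    𝓕 (fun x : ℝ => (Real.exp (-|x|) : ℂ)) w = 2 / (1 + (2 * Real.pi * w) ^ 2) := by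
  set c : ℂ := 2 * Real.pi * w * Complex.I with hc
  have hre : c.re = 0 := by simp [hc]
  have h1 : (1 - c).re > 0 := by simp [hre]
  have h2 : (-1 - c).re < 0 := by simp [hre]
  have e1 : EqOn (fun x : ℝ => Complex.exp ((1 - c) * x))
      (fun x : ℝ => Complex.exp ((-2 * Real.pi * x * w : ℝ) * Complex.I) •
        (Real.exp (-|x|) : ℂ)) (Iic 0) := by
    intro x hx
    simp only [abs_of_nonpos (show x ≤ 0 from hx), smul_eq_mul, Complex.ofReal_exp]
    rw [← Complex.exp_add, hc]
    congr 1; push_cast; ring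
  have e2 : EqOn (fun x : ℝ => Complex.exp ((-1 - c) * x))
      (fun x : ℝ => Complex.exp ((-2 * Real.pi * x * w : ℝ) * Complex.I) •
        (Real.exp (-|x|) : ℂ)) (Ioi 0) := by
    intro x hx
    simp only [abs_of_pos (show 0 < x from hx), smul_eq_mul, Complex.ofReal_exp]
    rw [← Complex.exp_add, hc]
    congr 1; push_cast; ring
  have i1 := (integrableOn_exp_mul_complex_Iic h1 0).congr_fun e1 measurableSet_Iic
  have i2 := (integrableOn_exp_mul_complex_Ioi h2 0).congr_fun e2 measurableSet_Ioi
  have n1 : (1 - c) ≠ 0 := fun h => by simp [h] at h1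
  have n2 : (-1 - c) ≠ 0 := fun h => by simp [h] at h2
  have n3 : (1 + (2 * Real.pi * w : ℂ) ^ 2) ≠ 0 := by
    norm_cast; positivity
  rw [Real.fourier_real_eq_integral_exp_smul, ← intervalIntegral.integral_Iic_add_Ioi i1 i2,
    ← setIntegral_congr_fun measurableSet_Iic e1, ← setIntegral_congr_fun measurableSet_Ioi e2,
    integral_exp_mul_complex_Iic h1, integral_exp_mul_complex_Ioi h2]
  have h3 : (1 - c) * (-1 - c) = -(1 + (2 * Real.pi * w : ℂ) ^ 2) := by
    rw [hc]; linear_combination (4 * Real.pi ^ 2 * w ^ 2 : ℂ) * Complex.I_sq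
  simp only [Complex.ofReal_zero, mul_zero, Complex.exp_zero]
  rw [div_add_div _ _ n1 n2, h3, div_eq_div_iff (neg_ne_zero.2 n3) n3]
  ring

theorem integrable_exp_neg_abs : Integrable (fun x : ℝ => Real.exp (-|x|)) := by
  rw [← integrableOn_univ, ← Iic_union_Ioi (a := (0 : ℝ)), integrableOn_union]
  constructor
  · refine (integrableOn_exp_mul_Iic one_pos 0).congr_fun (fun x hx => ?_) measurableSet_Iic
    simp [abs_of_nonpos (show x ≤ 0 from hx)]
  · refine (integrableOn_exp_mul_Ioi (neg_one_lt_zero) 0).congr_fun (fun x hx => ?_)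
      measurableSet_Ioi
    simp [abs_of_pos (show 0 < x from hx)]

-- Fourier inversion for `exp (-|x|)`, followed by real parts and the substitution `θ = 2πv`.
open scoped FourierTransform in
theorem integral_cos_mul_inv_one_add_sq (a : ℝ) :
    ∫ θ : ℝ, Real.cos (a * θ) * (1 + θ ^ 2)⁻¹ = Real.pi * Real.exp (-|a|) := by
  have h2pi : (2 * Real.pi) ≠ 0 := by positivity
  have hF : 𝓕 (fun x : ℝ => (Real.exp (-|x|) : ℂ)) =
      fun w : ℝ => 2 * (((1 + (2 * Real.pi * w) ^ 2)⁻¹ : ℝ) : ℂ) := by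
    ext w
    rw [fourier_exp_neg_abs, div_eq_mul_inv]
    push_cast; rfl
  have hint : Integrable (𝓕 (fun x : ℝ => (Real.exp (-|x|) : ℂ))) := by
    rw [hF]
    exact ((integrable_inv_one_add_sq.comp_mul_left' h2pi).ofReal).const_mul 2
  have hcont : Continuous (fun x : ℝ => (Real.exp (-|x|) : ℂ)) := by fun_prop
  have key := congr_fun (hcont.fourierInv_fourier_eq integrable_exp_neg_abs.ofReal hint) a
  rw [Real.fourierInv_eq', hF] at key
  have hint' : Integrable (fun v : ℝ => Complex.exp (↑(2 * Real.pi * inner ℝ v a) * Complex.I) •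
      (2 * (((1 + (2 * Real.pi * v) ^ 2)⁻¹ : ℝ) : ℂ))) := by
    refine (hF ▸ hint).bdd_mul (c := 1) (by fun_prop) (ae_of_all _ fun v => ?_)
    rw [Complex.norm_exp_ofReal_mul_I]
  have key' := congr_arg Complex.re key
  rw [← RCLike.re_eq_complex_re, ← integral_re hint'] at key'
  have hfun : ∀ v : ℝ, RCLike.re (Complex.exp (↑(2 * Real.pi * inner ℝ v a) * Complex.I) •
      (2 * (((1 + (2 * Real.pi * v) ^ 2)⁻¹ : ℝ) : ℂ))) =
      (fun θ : ℝ => 2 * (Real.cos (a * θ) * (1 + θ ^ 2)⁻¹)) (2 * Real.pi * v) := by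
    intro v
    have : (2 * (((1 + (2 * Real.pi * v) ^ 2)⁻¹ : ℝ) : ℂ)) =
      ((2 * (1 + (2 * Real.pi * v) ^ 2)⁻¹ : ℝ) : ℂ) := by push_cast; ring
    rw [this, smul_eq_mul, RCLike.re_eq_complex_re, Complex.re_mul_ofReal,
      Complex.exp_ofReal_mul_I_re]
    simp only [RCLike.inner_apply, conj_trivial]
    rw [show 2 * Real.pi * (a * v) = a * (2 * Real.pi * v) by ring]
    ring
  simp_rw [hfun] at key'
  rw [Measure.integral_comp_mul_left (fun θ : ℝ => 2 * (Real.cos (a * θ) * (1 + θ ^ 2)⁻¹)),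
    integral_const_mul, abs_of_pos (by positivity),
    smul_eq_mul, RCLike.re_eq_complex_re, Complex.ofReal_re] at key'
  rw [← key']
  field_simp

/-! ### Gaussian integrals with a linear phase or an absolute value in the exponent. -/

section Gaussian

variable {V : Type*} [NormedAddCommGroup V] [InnerProductSpace ℝ V] [FiniteDimensional ℝ V]
  [MeasurableSpace V] [BorelSpace V]

theorem integral_cos_inner_mul_exp_neg_mul_sq_norm {b : ℝ} (hb : 0 < b) (c : ℝ) (v : V) :
    ∫ w : V, Real.cos (c * inner ℝ v w) * Real.exp (-b * ‖w‖ ^ 2) =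
      (Real.pi / b) ^ (Module.finrank ℝ V / 2 : ℝ) * Real.exp (-(c ^ 2 * ‖v‖ ^ 2 / (4 * b))) := by
  have hb' : 0 < (b : ℂ).re := by simpa
  have h := GaussianFourier.integral_cexp_neg_mul_sq_norm_add hb' (c * Complex.I) v
  have hi := GaussianFourier.integrable_cexp_neg_mul_sq_norm_add hb' (c * Complex.I) v
  have h' := congr_arg Complex.re h
  rw [← RCLike.re_eq_complex_re, ← integral_re hi] at h'
  convert h' using 1
  · congr 1; ext w
    rw [Complex.exp_add, RCLike.re_eq_complex_re,
      show (-(b : ℂ) * (‖w‖ : ℂ) ^ 2) = ((-b * ‖w‖ ^ 2 : ℝ) : ℂ) by push_cast; ring,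
      show ((c : ℂ) * Complex.I * (inner ℝ v w : ℝ)) = ((c * inner ℝ v w : ℝ) : ℂ) * Complex.I by
        push_cast; ring, ← Complex.ofReal_exp, Complex.re_ofReal_mul,
      Complex.exp_ofReal_mul_I_re, mul_comm]
  · rw [RCLike.re_eq_complex_re,
      show ((c : ℂ) * Complex.I) ^ 2 * (‖v‖ : ℂ) ^ 2 / (4 * b) =
        ((-(c ^ 2 * ‖v‖ ^ 2 / (4 * b)) : ℝ) : ℂ) by
          rw [mul_pow, Complex.I_sq]; push_cast; ring,
      show ((Real.pi : ℂ) / b) ^ ((Module.finrank ℝ V : ℂ) / 2) =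
        (((Real.pi / b) ^ (Module.finrank ℝ V / 2 : ℝ) : ℝ) : ℂ) by
          rw [Complex.ofReal_cpow (by positivity)]; push_cast; rfl,
      ← Complex.ofReal_exp, ← Complex.ofReal_mul, Complex.ofReal_re]

theorem integrable_exp_neg_mul_sq_norm {b : ℝ} (hb : 0 < b) :
    Integrable (fun w : V => Real.exp (-b * ‖w‖ ^ 2)) := by
  have := (GaussianFourier.integrable_cexp_neg_mul_sq_norm_add
    (show 0 < (b : ℂ).re by simpa) 0 (0 : V)).re
  refine this.congr (ae_of_all _ fun w => ?_)
  simp only [zero_mul, add_zero]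
  rw [show (-(b : ℂ) * (‖w‖ : ℂ) ^ 2) = ((-b * ‖w‖ ^ 2 : ℝ) : ℂ) by push_cast; ring,
    ← Complex.ofReal_exp]
  rfl

/-- The factor `exp (-b|⟨v, w⟩|)` is written as a Cauchy mixture of cosines; after Fubini each
cosine is integrated against the Gaussian in closed form. -/
theorem integral_exp_neg_mul_sq_norm_add_abs_inner {b : ℝ} (hb : 0 < b) (v : V) :
    ∫ w : V, Real.exp (-b * (‖w‖ ^ 2 + |inner ℝ v w|)) =
      ∫ θ : ℝ, Real.pi⁻¹ * (Real.pi / b) ^ (Module.finrank ℝ V / 2 : ℝ) * (1 + θ ^ 2)⁻¹ *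
        Real.exp (-(b * ‖v‖ ^ 2 * θ ^ 2 / 4)) := by
  have h1 : ∀ w : V, Real.exp (-b * (‖w‖ ^ 2 + |inner ℝ v w|)) =
      ∫ θ : ℝ, Real.pi⁻¹ * (Real.cos (b * θ * inner ℝ v w) * (1 + θ ^ 2)⁻¹ *
        Real.exp (-b * ‖w‖ ^ 2)) := by
    intro w
    rw [integral_const_mul, integral_mul_const]
    have := integral_cos_mul_inv_one_add_sq (b * inner ℝ v w)
    simp_rw [show ∀ θ : ℝ, b * inner ℝ v w * θ = b * θ * inner ℝ v w from fun θ => by ring]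
      at this
    rw [this, abs_mul, abs_of_pos hb, mul_assoc Real.pi, inv_mul_cancel_left₀ Real.pi_ne_zero,
      ← Real.exp_add]
    congr 1; ring
  simp_rw [h1]
  rw [integral_integral_swap]
  · congr 1; ext θ
    have := integral_cos_inner_mul_exp_neg_mul_sq_norm hb (b * θ) v
    rw [integral_const_mul]
    simp_rw [mul_right_comm _ ((1 + θ ^ 2)⁻¹)]
    rw [integral_mul_const, this]
    rw [show (b * θ) ^ 2 * ‖v‖ ^ 2 / (4 * b) = b * ‖v‖ ^ 2 * θ ^ 2 / 4 by field_simp]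
    ring
  · have hp : Integrable (fun q : V × ℝ => Real.exp (-b * ‖q.1‖ ^ 2) * (1 + q.2 ^ 2)⁻¹) :=
      (integrable_exp_neg_mul_sq_norm hb).mul_prod integrable_inv_one_add_sq
    refine Integrable.const_mul (c := Real.pi⁻¹) ?_
    have := hp.bdd_mul (c := 1) (f := fun q : V × ℝ => Real.cos (b * q.2 * inner ℝ v q.1))
      (by fun_prop) (ae_of_all _ fun q => by simpa using Real.abs_cos_le_one _)
    refine this.congr (ae_of_all _ fun q => ?_)
    ring

end Gaussian

/-! ### Averaged ball autocorrelations as mixtures of Gaussian ones. -/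

theorem lintegral_Ioi_mul_exp_neg_mul_sq {b : ℝ} (hb : 0 < b) {r : ℝ} (hr : 0 ≤ r) :
    ∫⁻ R in Ioi r, ENNReal.ofReal (R * Real.exp (-b * R ^ 2)) =
      ENNReal.ofReal ((2 * b)⁻¹ * Real.exp (-b * r ^ 2)) := by
  have hd : ∀ x ∈ Ici r, HasDerivAt (fun R : ℝ => -(2 * b)⁻¹ * Real.exp (-b * R ^ 2))
      (x * Real.exp (-b * x ^ 2)) x := by
    intro x _
    refine ((((hasDerivAt_pow 2 x).const_mul (-b)).exp).const_mul (-(2 * b)⁻¹)).congr_deriv ?_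
    field_simp
    simp
  have hpos : ∀ x ∈ Ioi r, 0 ≤ x * Real.exp (-b * x ^ 2) := fun x hx =>
    mul_nonneg (hr.trans (le_of_lt hx)) (Real.exp_pos _).le
  have ht : Tendsto (fun R : ℝ => -(2 * b)⁻¹ * Real.exp (-b * R ^ 2)) atTop (nhds 0) := by
    rw [← mul_zero (-(2 * b)⁻¹)]
    refine Tendsto.const_mul _ (Real.tendsto_exp_atBot.comp ?_)
    exact (tendsto_pow_atTop two_ne_zero).const_mul_atTop_of_neg (neg_lt_zero.2 hb)
  have hi := integrableOn_Ioi_deriv_of_nonneg' hd hpos ht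
  rw [← ofReal_integral_eq_lintegral_ofReal hi
    ((ae_restrict_iff' measurableSet_Ioi).2 (ae_of_all _ hpos)),
    integral_Ioi_of_hasDerivAt_of_tendsto' hd hi ht]
  congr 1; ring

/-- The unnormalized Gaussian `x ↦ exp (-2t‖x‖²)`. -/
noncomputable def gaussianBump {V : Type*} [NormedAddCommGroup V] (t : ℝ) (x : V) : ℝ≥0∞ :=
  ENNReal.ofReal (Real.exp (-(2 * t) * ‖x‖ ^ 2))

theorem measurable_gaussianBump_uncurry {V : Type*} [NormedAddCommGroup V] [MeasurableSpace V]
    [BorelSpace V] :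
    Measurable (fun q : ℝ × V => gaussianBump q.1 q.2) := by
  unfold gaussianBump; fun_prop

theorem measurable_gaussianBump {V : Type*} [NormedAddCommGroup V] [MeasurableSpace V]
    [BorelSpace V] (t : ℝ) : Measurable (gaussianBump (V := V) t) := by
  unfold gaussianBump; fun_prop

section Gaussian

variable {V : Type*} [NormedAddCommGroup V] [InnerProductSpace ℝ V] [FiniteDimensional ℝ V]
  [MeasurableSpace V] [BorelSpace V]

/-- Shifting by `v/2` makes the two norms symmetric: their squares are `‖w‖² + ‖v‖²/4 ± ⟨v, w⟩`, and
the maximum turns the sign into an absolute value. -/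
theorem lintegral_exp_neg_mul_max_sq_norm {b : ℝ} (hb : 0 < b) (v : V) :
    ∫⁻ z : V, ENNReal.ofReal (Real.exp (-b * max ‖z + v‖ ‖z‖ ^ 2)) =
      ∫⁻ θ : ℝ, ENNReal.ofReal (Real.pi⁻¹ * (Real.pi / b) ^ (Module.finrank ℝ V / 2 : ℝ) *
        (1 + θ ^ 2)⁻¹ * Real.exp (-(b * (1 + θ ^ 2) / 4 * ‖v‖ ^ 2))) := by
  rw [← lintegral_sub_right_eq_self _ ((1 / 2 : ℝ) • v)]
  have hmax : ∀ w : V, max ‖w - (1 / 2 : ℝ) • v + v‖ ‖w - (1 / 2 : ℝ) • v‖ ^ 2 =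
      ‖w‖ ^ 2 + |inner ℝ v w| + ‖v‖ ^ 2 / 4 := by
    intro w
    have e1 : w - (1 / 2 : ℝ) • v + v = w + (1 / 2 : ℝ) • v := by module
    have h1 := norm_add_sq_real w ((1 / 2 : ℝ) • v)
    have h2 := norm_sub_sq_real w ((1 / 2 : ℝ) • v)
    rw [inner_smul_right, norm_smul, real_inner_comm] at h1 h2
    norm_num at h1 h2
    rw [e1]
    rcases le_total 0 (inner ℝ v w : ℝ) with h | h
    · rw [max_eq_left, abs_of_nonneg h]
      · norm_num; linarith
      · refine le_of_sq_le_sq ?_ (norm_nonneg _)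
        norm_num; linarith
    · rw [max_eq_right, abs_of_nonpos h]
      · norm_num; linarith
      · refine le_of_sq_le_sq ?_ (norm_nonneg _)
        norm_num; linarith
  simp_rw [hmax]
  have hc : ∀ w : V, Real.exp (-b * (‖w‖ ^ 2 + |inner ℝ v w| + ‖v‖ ^ 2 / 4)) =
      Real.exp (-b * (‖v‖ ^ 2 / 4)) * Real.exp (-b * (‖w‖ ^ 2 + |inner ℝ v w|)) := by
    intro w
    rw [← Real.exp_add]; congr 1; ring
  have hc' : ∀ θ : ℝ, Real.pi⁻¹ * (Real.pi / b) ^ (Module.finrank ℝ V / 2 : ℝ) *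
      (1 + θ ^ 2)⁻¹ * Real.exp (-(b * (1 + θ ^ 2) / 4 * ‖v‖ ^ 2)) =
      Real.exp (-b * (‖v‖ ^ 2 / 4)) *
      (Real.pi⁻¹ * (Real.pi / b) ^ (Module.finrank ℝ V / 2 : ℝ) * (1 + θ ^ 2)⁻¹ *
        Real.exp (-(b * ‖v‖ ^ 2 * θ ^ 2 / 4))) := by
    intro θ
    rw [mul_left_comm, ← Real.exp_add]; congr 2; ring
  have i1 : Integrable fun w : V => Real.exp (-b * (‖w‖ ^ 2 + |inner ℝ v w|)) := by
    refine (integrable_exp_neg_mul_sq_norm (V := V) hb).mono' (by fun_prop) (ae_of_all _ fun w => ?_)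
    rw [Real.norm_of_nonneg (Real.exp_pos _).le]
    refine Real.exp_le_exp.2 ?_
    nlinarith [mul_nonneg hb.le (abs_nonneg (inner ℝ v w : ℝ))]
  have i2 : Integrable fun θ : ℝ => Real.pi⁻¹ * (Real.pi / b) ^ (Module.finrank ℝ V / 2 : ℝ) *
      (1 + θ ^ 2)⁻¹ * Real.exp (-(b * ‖v‖ ^ 2 * θ ^ 2 / 4)) := by
    refine (integrable_inv_one_add_sq.const_mul _).mul_bdd (c := 1) (by fun_prop)
      (ae_of_all _ fun θ => ?_)
    rw [Real.norm_of_nonneg (Real.exp_pos _).le, Real.exp_le_one_iff]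
    simp only [Left.neg_nonpos_iff]; positivity
  simp_rw [hc, hc']
  rw [← ofReal_integral_eq_lintegral_ofReal (i1.const_mul _) (ae_of_all _ fun w => by positivity),
    ← ofReal_integral_eq_lintegral_ofReal (i2.const_mul _) (ae_of_all _ fun w => by positivity),
    integral_const_mul, integral_const_mul, integral_exp_neg_mul_sq_norm_add_abs_inner hb]

theorem lintegral_gaussianBump {t : ℝ} (ht : 0 < t) :
    ∫⁻ x : V, gaussianBump t x =
      ENNReal.ofReal ((Real.pi / (2 * t)) ^ (Module.finrank ℝ V / 2 : ℝ)) := by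
  have h2 : 0 < 2 * t := by positivity
  rw [← GaussianFourier.integral_rexp_neg_mul_sq_norm h2]
  exact (ofReal_integral_eq_lintegral_ofReal (integrable_exp_neg_mul_sq_norm h2)
    (ae_of_all _ fun x => (Real.exp_pos _).le)).symm

theorem lintegral_gaussianBump_mul {t : ℝ} (ht : 0 < t) (v : V) :
    ∫⁻ z : V, gaussianBump t (z + v) * gaussianBump t z =
      ENNReal.ofReal ((Real.pi / (4 * t)) ^ (Module.finrank ℝ V / 2 : ℝ) *
        Real.exp (-(t * ‖v‖ ^ 2))) := by
  rw [← lintegral_sub_right_eq_self _ ((1 / 2 : ℝ) • v)]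
  have h2 : 0 < 2 * t := by positivity
  have : ∀ w : V, gaussianBump t (w - (1 / 2 : ℝ) • v + v) * gaussianBump t (w - (1 / 2 : ℝ) • v) =
      ENNReal.ofReal (Real.exp (-(t * ‖v‖ ^ 2))) * gaussianBump (2 * t) w := by
    intro w
    have e1 : w - (1 / 2 : ℝ) • v + v = w + (1 / 2 : ℝ) • v := by module
    have h1 := norm_add_sq_real w ((1 / 2 : ℝ) • v)
    have h2 := norm_sub_sq_real w ((1 / 2 : ℝ) • v)
    rw [inner_smul_right, norm_smul] at h1 h2
    unfold gaussianBump
    rw [e1, ← ENNReal.ofReal_mul (Real.exp_pos _).le, ← ENNReal.ofReal_mul (Real.exp_pos _).le,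
      ← Real.exp_add, ← Real.exp_add, h1, h2]
    congr 2
    norm_num
    ring
  simp_rw [this]
  rw [lintegral_const_mul _ (measurable_gaussianBump _), lintegral_gaussianBump h2,
    ← ENNReal.ofReal_mul (Real.exp_pos _).le, mul_comm, show 2 * (2 * t) = 4 * t by ring]

/-- The density of the mixture of Gaussians that represents the mixture of the functions
`1_{B_R} ⋆ 1_{B_R}` with weight `R exp (-bR²) dR`. -/
noncomputable def mixtureDensity (d : ℕ) (b θ : ℝ) : ℝ :=
  (2 * b * Real.pi)⁻¹ * (1 + θ ^ 2)⁻¹ * (1 + θ ^ 2) ^ (d / 2 : ℝ)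

/-- For fixed `z`, both points lie in `B_R` exactly when `R > max(‖z + v‖, ‖z‖)`, so the
`R`-integral is an explicit Gaussian tail. What matters later is that the mixing density is
nonnegative and does not depend on `v`. -/
theorem lintegral_ball_correlation {b : ℝ} (hb : 0 < b) (v : V) :
    ∫⁻ R in Ioi (0 : ℝ), ENNReal.ofReal (R * Real.exp (-b * R ^ 2)) *
        ∫⁻ z : V, (Metric.ball 0 R).indicator 1 (z + v) * (Metric.ball 0 R).indicator 1 z =
      ∫⁻ θ : ℝ, ENNReal.ofReal (mixtureDensity (Module.finrank ℝ V) b θ) *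
        ∫⁻ z : V, gaussianBump (b * (1 + θ ^ 2) / 4) (z + v) *
          gaussianBump (b * (1 + θ ^ 2) / 4) z := by
  have hind : ∀ (R : ℝ) (z : V), ENNReal.ofReal (R * Real.exp (-b * R ^ 2)) *
      ((Metric.ball 0 R).indicator 1 (z + v) * (Metric.ball 0 R).indicator 1 z) =
      (Ioi (max ‖z + v‖ ‖z‖)).indicator (fun R => ENNReal.ofReal (R * Real.exp (-b * R ^ 2))) R := by
    intro R z
    by_cases h1 : ‖z + v‖ < R <;> by_cases h2 : ‖z‖ < R <;> simp [indicator, h1, h2]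
  have hm : Measurable fun q : ℝ × V => ENNReal.ofReal (q.1 * Real.exp (-b * q.1 ^ 2)) *
      ((Metric.ball 0 q.1).indicator 1 (q.2 + v) * (Metric.ball 0 q.1).indicator 1 q.2) := by
    simp_rw [hind]
    exact Measurable.indicator (s := {q : ℝ × V | max ‖q.2 + v‖ ‖q.2‖ < q.1}) (by fun_prop)
      (measurableSet_lt (by fun_prop) (by fun_prop))
  have hl : ∀ R : ℝ, ENNReal.ofReal (R * Real.exp (-b * R ^ 2)) *
        ∫⁻ z : V, (Metric.ball 0 R).indicator 1 (z + v) * (Metric.ball 0 R).indicator 1 z =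
      ∫⁻ z : V, ENNReal.ofReal (R * Real.exp (-b * R ^ 2)) *
      ((Metric.ball 0 R).indicator 1 (z + v) * (Metric.ball 0 R).indicator 1 z) := fun R =>
    (lintegral_const_mul' _ _ ENNReal.ofReal_ne_top).symm
  simp_rw [hl]
  rw [lintegral_lintegral_swap hm.aemeasurable]
  have hR : ∀ z : V, ∫⁻ R in Ioi (0 : ℝ), ENNReal.ofReal (R * Real.exp (-b * R ^ 2)) *
      ((Metric.ball 0 R).indicator 1 (z + v) * (Metric.ball 0 R).indicator 1 z) =
      ENNReal.ofReal (2 * b)⁻¹ * ENNReal.ofReal (Real.exp (-b * max ‖z + v‖ ‖z‖ ^ 2)) := by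
    intro z
    have h0 : 0 ≤ max ‖z + v‖ ‖z‖ := le_max_of_le_right (norm_nonneg _)
    simp_rw [hind]
    rw [lintegral_indicator measurableSet_Ioi, Measure.restrict_restrict measurableSet_Ioi,
      inter_eq_left.2 (Ioi_subset_Ioi h0), lintegral_Ioi_mul_exp_neg_mul_sq hb h0,
      ENNReal.ofReal_mul (by positivity)]
  simp_rw [hR]
  rw [lintegral_const_mul' _ _ ENNReal.ofReal_ne_top, lintegral_exp_neg_mul_max_sq_norm hb,
    ← lintegral_const_mul' _ _ ENNReal.ofReal_ne_top]
  refine lintegral_congr fun θ => ?_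
  have ht : 0 < 1 + θ ^ 2 := by positivity
  rw [lintegral_gaussianBump_mul (by positivity), ← ENNReal.ofReal_mul (by positivity),
    ← ENNReal.ofReal_mul (by unfold mixtureDensity; positivity)]
  congr 1
  unfold mixtureDensity
  have hp : (Real.pi / b) ^ (Module.finrank ℝ V / 2 : ℝ) =
      (1 + θ ^ 2) ^ (Module.finrank ℝ V / 2 : ℝ) *
      (Real.pi / (4 * (b * (1 + θ ^ 2) / 4))) ^ (Module.finrank ℝ V / 2 : ℝ) := by
    rw [← Real.mul_rpow (by positivity) (by positivity)]
    congr 1; field_simp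
  rw [hp, mul_inv (2 * b)]
  ring

end Gaussian

/-! ### The tautological kernel and measurability of linear statistics. -/

/-- The masses need not be uniformly bounded; cutting the source by the integer part of the mass
makes each piece a finite kernel. -/
theorem ProbabilityTheory.Kernel.isSFiniteKernel_of_lt_top {α β : Type*} [MeasurableSpace α]
    [MeasurableSpace β] (κ : Kernel α β) (h : ∀ a, κ a univ < ∞) : IsSFiniteKernel κ := by
  classical
  let s : ℕ → Set α := fun k => {a | ⌊(κ a univ).toReal⌋₊ = k}
  have hs : ∀ k, MeasurableSet (s k) := fun k =>
    (Nat.measurable_floor.comp (κ.measurable_coe MeasurableSet.univ).ennreal_toReal)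
      (measurableSet_singleton k)
  have hfin : ∀ k, IsFiniteKernel (Kernel.piecewise (hs k) κ 0) := by
    intro k
    refine ⟨⟨ENNReal.ofReal (k + 1), ENNReal.ofReal_lt_top, fun a => ?_⟩⟩
    rw [Kernel.piecewise_apply]
    split_ifs with ha
    · refine ENNReal.le_ofReal_iff_toReal_le (h a).ne (by positivity) |>.2 ?_
      rw [← show ⌊(κ a univ).toReal⌋₊ = k from ha]
      exact (Nat.lt_floor_add_one _).le
    · simp
  have hsum : κ = Kernel.sum fun k => Kernel.piecewise (hs k) κ 0 := by
    ext a t ht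
    rw [Kernel.sum_apply' _ _ ht, tsum_eq_single ⌊(κ a univ).toReal⌋₊]
    · rw [Kernel.piecewise_apply, if_pos (show a ∈ s _ from rfl)]
    · intro k hk
      rw [Kernel.piecewise_apply, if_neg (show a ∉ s k from fun h' => hk h'.symm)]
      simp
  rw [hsum]
  infer_instance

theorem ProbabilityTheory.Kernel.isSFiniteKernel_of_iUnion {α β : Type*} [MeasurableSpace α]
    [MeasurableSpace β] (κ : Kernel α β) (D : ℕ → Set β) (hD : ∀ j, MeasurableSet (D j))
    (hdisj : Pairwise (Function.onFun Disjoint D)) (hU : ⋃ j, D j = univ)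
    (h : ∀ a j, κ a (D j) < ∞) : IsSFiniteKernel κ := by
  have hsum : κ = Kernel.sum fun j => κ.restrict (hD j) := by
    ext a : 1
    rw [Kernel.sum_apply]
    simp_rw [Kernel.restrict_apply]
    rw [← Measure.restrict_iUnion hdisj hD, hU, Measure.restrict_univ]
  have : ∀ j, IsSFiniteKernel (κ.restrict (hD j)) := fun j =>
    Kernel.isSFiniteKernel_of_lt_top _ fun a => by
      rw [Kernel.restrict_apply, Measure.restrict_apply_univ]; exact h a j
  rw [hsum]
  exact Kernel.isSFiniteKernel_sum

namespace LocFinMeasure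

variable {n : ℕ}

theorem lt_top_of_isBounded (p : LocFinMeasure n) {B : Set (EuclideanSpace ℝ (Fin n))}
    (hB : Bornology.IsBounded B) : p.1 B < ∞ := by
  have := p.2
  exact hB.measure_lt_top

/-- The tautological kernel `p ↦ p`. -/
def toKernel (n : ℕ) : Kernel (LocFinMeasure n) (EuclideanSpace ℝ (Fin n)) :=
  ⟨fun p => p.1, measurable_subtype_coe⟩

instance : IsSFiniteKernel (toKernel n) := by
  refine Kernel.isSFiniteKernel_of_iUnion _ (fun j : ℕ => {x | ⌊‖x‖⌋₊ = j}) (fun j => ?_) ?_ ?_ ?_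
  · exact (Nat.measurable_floor.comp measurable_norm) (measurableSet_singleton j)
  · intro i j hij
    exact disjoint_left.2 fun x hi hj => hij (hi.symm.trans hj)
  · ext x; simp
  · intro p j
    refine lt_top_of_isBounded p ((Metric.isBounded_ball (x := 0) (r := j + 1)).subset ?_)
    rintro x rfl
    simpa using Nat.lt_floor_add_one ‖x‖

theorem measurable_apply {B : Set (EuclideanSpace ℝ (Fin n))} (hB : MeasurableSet B) :
    Measurable fun p : LocFinMeasure n => p.1 B :=
  (toKernel n).measurable_coe hB

theorem measurable_lintegral {α : Type*} [MeasurableSpace α]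
    {f : α → EuclideanSpace ℝ (Fin n) → ℝ≥0∞} (hf : Measurable (Function.uncurry f)) :
    Measurable fun q : α × LocFinMeasure n => ∫⁻ x, f q.1 x ∂q.2.1 :=
  Measurable.lintegral_kernel_prod_right' (κ := (toKernel n).prodMkLeft α)
    (f := fun q : (α × LocFinMeasure n) × EuclideanSpace ℝ (Fin n) => f q.1.1 q.2)
    (hf.comp (show Measurable fun q : (α × LocFinMeasure n) × EuclideanSpace ℝ (Fin n) => (q.1.1, q.2)
      by fun_prop))

theorem measurable_lintegral_const {f : EuclideanSpace ℝ (Fin n) → ℝ≥0∞} (hf : Measurable f) :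
    Measurable fun p : LocFinMeasure n => ∫⁻ x, f x ∂p.1 :=
  Measurable.lintegral_kernel (κ := toKernel n) hf

theorem lintegral_translate (x : EuclideanSpace ℝ (Fin n)) (p : LocFinMeasure n)
    {f : EuclideanSpace ℝ (Fin n) → ℝ≥0∞} (hf : Measurable f) :
    ∫⁻ y, f y ∂(translate x p).1 = ∫⁻ y, f (x + y) ∂p.1 :=
  lintegral_map hf (by fun_prop)

instance (p : LocFinMeasure n) : IsLocallyFiniteMeasure p.1 := p.2

end LocFinMeasure

/-! ### First and second moment measures of an invariant random measure. -/

namespace RandomMeasure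

open LocFinMeasure

variable {n : ℕ} {μ : Measure (LocFinMeasure n)}

theorem IsInvariant.lintegral_translate (hinv : IsInvariant μ) (x : EuclideanSpace ℝ (Fin n))
    {F : LocFinMeasure n → ℝ≥0∞} (hF : Measurable F) :
    ∫⁻ p, F (translate x p) ∂μ = ∫⁻ p, F p ∂μ := by
  conv_rhs => rw [← hinv x]
  exact (lintegral_map hF (measurable_translate x)).symm

/-- The intensity measure `B ↦ ∫ p(B) dμ(p)`. -/
noncomputable def intensity (μ : Measure (LocFinMeasure n)) :
    Measure (EuclideanSpace ℝ (Fin n)) :=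
  μ.bind (toKernel n)

theorem lintegral_intensity {f : EuclideanSpace ℝ (Fin n) → ℝ≥0∞} (hf : Measurable f) :
    ∫⁻ x, f x ∂(intensity μ) = ∫⁻ p, ∫⁻ x, f x ∂p.1 ∂μ :=
  Measure.lintegral_bind (toKernel n).measurable.aemeasurable hf.aemeasurable

/-- The intensity is translation invariant and finite on compacts (from `s ≤ 1 + s²`), so uniqueness
of Haar measure applies. -/
theorem exists_intensity_eq_smul_volume [IsProbabilityMeasure μ] (hinv : IsInvariant μ)
    (hsq : IsLocallySquareIntegrable μ) :
    ∃ m : ℝ≥0, ∀ f : EuclideanSpace ℝ (Fin n) → ℝ≥0∞, Measurable f →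
      ∫⁻ p, ∫⁻ x, f x ∂p.1 ∂μ = m * ∫⁻ x, f x := by
  have hleft : (intensity μ).IsAddLeftInvariant := by
    refine ⟨fun x => Measure.ext_of_lintegral _ fun f hf => ?_⟩
    rw [lintegral_map hf (by fun_prop), lintegral_intensity hf,
      lintegral_intensity (f := fun a => f (x + a)) (by fun_prop),
      ← hinv.lintegral_translate x (measurable_lintegral_const hf)]
    refine lintegral_congr fun p => ?_
    rw [LocFinMeasure.lintegral_translate x p hf]
  have hfin : IsFiniteMeasureOnCompacts (intensity μ) := by
    refine ⟨fun K hK => ?_⟩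
    rw [← lintegral_indicator_one hK.measurableSet,
      lintegral_intensity (measurable_one.indicator hK.measurableSet)]
    simp_rw [lintegral_indicator_one hK.measurableSet]
    calc ∫⁻ p, p.1 K ∂μ ≤ ∫⁻ p, (1 + p.1 K ^ 2) ∂μ := by
          refine lintegral_mono fun p => ?_
          rcases le_total (p.1 K) 1 with h | h
          · exact h.trans le_self_add
          · refine le_trans ?_ le_add_self
            rw [pow_two]
            exact le_mul_of_one_le_left' h
      _ = 1 + ∫⁻ p, p.1 K ^ 2 ∂μ := by
          rw [lintegral_add_left measurable_const, lintegral_const, measure_univ, mul_one]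
      _ < ∞ := ENNReal.add_lt_top.2 ⟨ENNReal.one_lt_top, hsq K hK.measurableSet hK.isBounded⟩
  refine ⟨(intensity μ).addHaarScalarFactor volume, fun f hf => ?_⟩
  rw [← lintegral_intensity hf, ← smul_eq_mul, ← ENNReal.smul_def, ← lintegral_smul_measure,
    ← Measure.isAddLeftInvariant_eq_smul]

/-- The second moment measure `A × B ↦ ∫ p(A) p(B) dμ(p)`. -/
noncomputable def secondMoment (μ : Measure (LocFinMeasure n)) :
    Measure (EuclideanSpace ℝ (Fin n) × EuclideanSpace ℝ (Fin n)) :=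
  μ.bind (toKernel n ×ₖ toKernel n)

theorem lintegral_secondMoment
    {f : EuclideanSpace ℝ (Fin n) × EuclideanSpace ℝ (Fin n) → ℝ≥0∞} (hf : Measurable f) :
    ∫⁻ q, f q ∂(secondMoment μ) = ∫⁻ p, ∫⁻ x, ∫⁻ y, f (x, y) ∂p.1 ∂p.1 ∂μ := by
  rw [secondMoment, Measure.lintegral_bind (Kernel.measurable _).aemeasurable hf.aemeasurable]
  refine lintegral_congr fun p => ?_
  rw [Kernel.lintegral_prod _ _ _ hf]
  rfl

theorem lintegral_secondMoment_mul {φ ψ : EuclideanSpace ℝ (Fin n) → ℝ≥0∞} (hφ : Measurable φ)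
    (hψ : Measurable ψ) :
    ∫⁻ q, φ q.1 * ψ q.2 ∂(secondMoment μ) =
      ∫⁻ p, (∫⁻ x, φ x ∂p.1) * (∫⁻ y, ψ y ∂p.1) ∂μ := by
  rw [lintegral_secondMoment (by fun_prop)]
  refine lintegral_congr fun p => ?_
  simp_rw [lintegral_const_mul _ hψ]
  rw [lintegral_mul_const _ hφ]

theorem IsInvariant.lintegral_secondMoment_add (hinv : IsInvariant μ)
    (z : EuclideanSpace ℝ (Fin n))
    {f : EuclideanSpace ℝ (Fin n) × EuclideanSpace ℝ (Fin n) → ℝ≥0∞} (hf : Measurable f) :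
    ∫⁻ q, f (z + q.1, z + q.2) ∂(secondMoment μ) = ∫⁻ q, f q ∂(secondMoment μ) := by
  have hF : Measurable fun p : LocFinMeasure n => ∫⁻ x, ∫⁻ y, f (x, y) ∂p.1 ∂p.1 := by
    have h := hf.lintegral_kernel (κ := toKernel n ×ₖ toKernel n)
    simp_rw [Kernel.lintegral_prod _ _ _ hf] at h
    exact h
  rw [lintegral_secondMoment (f := fun q => f (z + q.1, z + q.2)) (by fun_prop), lintegral_secondMoment hf,
    ← hinv.lintegral_translate z hF]
  refine lintegral_congr fun p => ?_
  have h1 : Measurable fun x => ∫⁻ y, f (x, y) ∂(translate z p).1 :=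
    hf.lintegral_prod_right'
  rw [LocFinMeasure.lintegral_translate z p h1]
  refine lintegral_congr fun x => ?_
  rw [LocFinMeasure.lintegral_translate z p (f := fun y => f (z + x, y)) (by fun_prop)]

/-- The second moment measure is invariant under diagonal translations, so it factors as Lebesgue
measure times a measure `ρ` in the difference variable. Weighting the first coordinate by a density
`η` of total mass one selects `ρ` without a disintegration theorem. -/
theorem exists_reduced_secondMoment [SFinite μ] (hinv : IsInvariant μ) :
    ∃ ρ : Measure (EuclideanSpace ℝ (Fin n)), SFinite ρ ∧
      ∀ φ ψ : EuclideanSpace ℝ (Fin n) → ℝ≥0∞, Measurable φ → Measurable ψ →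
        ∫⁻ p, (∫⁻ x, φ x ∂p.1) * (∫⁻ y, ψ y ∂p.1) ∂μ =
          ∫⁻ v, (∫⁻ z, φ (z + v) * ψ z) ∂ρ := by
  have hM : SFinite (secondMoment μ) := by unfold secondMoment; infer_instance
  set B : Set (EuclideanSpace ℝ (Fin n)) := Metric.ball 0 1
  have hB : MeasurableSet B := measurableSet_ball
  set η : EuclideanSpace ℝ (Fin n) → ℝ≥0∞ := B.indicator fun _ => (volume B)⁻¹
  have hη : Measurable η := measurable_const.indicator hB
  have hη1 : ∫⁻ x, η x = 1 := by
    rw [lintegral_indicator_const hB]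
    exact ENNReal.inv_mul_cancel (Metric.measure_ball_pos volume _ one_pos).ne'
      measure_ball_lt_top.ne
  refine ⟨((secondMoment μ).withDensity fun q => η q.1).map fun q => q.1 - q.2, inferInstance,
    fun φ ψ hφ hψ => ?_⟩
  have hη' : Measurable fun q : EuclideanSpace ℝ (Fin n) × EuclideanSpace ℝ (Fin n) => η q.1 :=
    hη.comp measurable_fst
  have hmeas : Measurable fun v => ∫⁻ z, φ (z + v) * ψ z :=
    Measurable.lintegral_prod_right' (f := fun q : EuclideanSpace ℝ (Fin n) ×
      EuclideanSpace ℝ (Fin n) => φ (q.2 + q.1) * ψ q.2) (by fun_prop)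
  have hmeas' : Measurable fun q : EuclideanSpace ℝ (Fin n) × EuclideanSpace ℝ (Fin n) =>
      ∫⁻ z, φ (z + (q.1 - q.2)) * ψ z := hmeas.comp (by fun_prop)
  rw [lintegral_map hmeas (by fun_prop), lintegral_withDensity_eq_lintegral_mul _ hη' hmeas', ← lintegral_secondMoment_mul hφ hψ]
  have h1 : ∀ q : EuclideanSpace ℝ (Fin n) × EuclideanSpace ℝ (Fin n),
      η q.1 * (∫⁻ z, φ (z + (q.1 - q.2)) * ψ z) =
        ∫⁻ z, η q.1 * (φ (q.1 - z) * ψ (q.2 - z)) := by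
    intro q
    rw [lintegral_const_mul _ (by fun_prop),
      ← lintegral_sub_left_eq_self (fun z => φ (z + (q.1 - q.2)) * ψ z) q.2]
    congr 2; ext z
    rw [show q.2 - z + (q.1 - q.2) = q.1 - z by abel]
  simp only [Pi.mul_apply]
  simp_rw [h1]
  rw [lintegral_lintegral_swap (by fun_prop)]
  -- After the diagonal shift by `z`, the variable `z` survives only inside `η`, which integrates to
  -- one.
  have h2 : ∀ z : EuclideanSpace ℝ (Fin n),
      ∫⁻ q, η q.1 * (φ (q.1 - z) * ψ (q.2 - z)) ∂(secondMoment μ) =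
        ∫⁻ q, η (z + q.1) * (φ q.1 * ψ q.2) ∂(secondMoment μ) := by
    intro z
    rw [← hinv.lintegral_secondMoment_add z (by fun_prop)]
    simp
  simp_rw [h2]
  rw [lintegral_lintegral_swap (by fun_prop)]
  refine lintegral_congr fun q => ?_
  rw [lintegral_mul_const _ (by fun_prop), lintegral_add_right_eq_self, hη1, one_mul]

end RandomMeasure

/-! ### Jensen's inequality and variance for extended nonnegative variables. -/

theorem ENNReal.two_mul_le_add_sq' (a b : ℝ≥0∞) : 2 * a * b ≤ a ^ 2 + b ^ 2 := by
  rcases eq_or_ne a ∞ with rfl | ha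
  · simp
  rcases eq_or_ne b ∞ with rfl | hb
  · simp
  lift a to ℝ≥0 using ha
  lift b to ℝ≥0 using hb
  exact_mod_cast two_mul_le_add_sq a b

section Jensen

variable {Ω : Type*} [MeasurableSpace Ω] {P : Measure Ω} [IsProbabilityMeasure P] {X : Ω → ℝ≥0∞}

theorem sq_lintegral_le_lintegral_sq (hX : Measurable X) (hfin : ∫⁻ ω, X ω ∂P ≠ ∞) :
    (∫⁻ ω, X ω ∂P) ^ 2 ≤ ∫⁻ ω, X ω ^ 2 ∂P := by
  set a := ∫⁻ ω, X ω ∂P with ha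
  have h : ∫⁻ ω, 2 * a * X ω ∂P ≤ ∫⁻ ω, (a ^ 2 + X ω ^ 2) ∂P :=
    lintegral_mono fun ω => ENNReal.two_mul_le_add_sq' _ _
  rw [lintegral_const_mul _ hX, ← ha, lintegral_add_left measurable_const, lintegral_const,
    measure_univ, mul_one, mul_assoc, two_mul, ← pow_two] at h
  exact (ENNReal.add_le_add_iff_left (ENNReal.pow_ne_top hfin)).1 h

/-- Only the mean has to be finite; the second moment may be infinite. -/
theorem lintegral_sq_eq_evariance_add (hX : Measurable X) (hfin : ∫⁻ ω, X ω ∂P ≠ ∞) :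
    ∫⁻ ω, X ω ^ 2 ∂P =
      evariance (fun ω => (X ω).toReal) P + (∫⁻ ω, X ω ∂P) ^ 2 := by
  have hae : ∀ᵐ ω ∂P, X ω < ∞ := ae_lt_top hX hfin
  have h1 : ∫⁻ ω, ‖(X ω).toReal‖ₑ ^ 2 ∂P = ∫⁻ ω, X ω ^ 2 ∂P := by
    refine lintegral_congr_ae (hae.mono fun ω hω => ?_)
    simp only
    rw [Real.enorm_of_nonneg ENNReal.toReal_nonneg, ENNReal.ofReal_toReal hω.ne]
  have h2 : ENNReal.ofReal ((∫ ω, (X ω).toReal ∂P) ^ 2) = (∫⁻ ω, X ω ∂P) ^ 2 := by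
    rw [integral_toReal hX.aemeasurable hae, ENNReal.ofReal_pow ENNReal.toReal_nonneg,
      ENNReal.ofReal_toReal hfin]
  rw [evariance_def' hX.ennreal_toReal.aestronglyMeasurable, h1, h2,
    tsub_add_cancel_of_le (sq_lintegral_le_lintegral_sq hX hfin)]

theorem ae_eq_lintegral_of_lintegral_sq_le (hX : Measurable X) (hfin : ∫⁻ ω, X ω ∂P ≠ ∞)
    (h : ∫⁻ ω, X ω ^ 2 ∂P ≤ (∫⁻ ω, X ω ∂P) ^ 2) : ∀ᵐ ω ∂P, X ω = ∫⁻ ω, X ω ∂P := by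
  have hae : ∀ᵐ ω ∂P, X ω < ∞ := ae_lt_top hX hfin
  have h0 : evariance (fun ω => (X ω).toReal) P = 0 := by
    rw [lintegral_sq_eq_evariance_add hX hfin] at h
    have := (ENNReal.add_le_add_iff_right (ENNReal.pow_ne_top hfin)).1 (h.trans_eq (zero_add _).symm)
    exact le_antisymm this zero_le
  rw [evariance_eq_zero_iff hX.ennreal_toReal.aemeasurable] at h0
  filter_upwards [h0, hae] with ω h1 h2
  rw [integral_toReal hX.aemeasurable hae] at h1
  exact (ENNReal.toReal_eq_toReal_iff' h2.ne hfin).1 h1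

end Jensen

/-! ### The mixture identity integrated against a measure in `v`. -/

theorem lintegral_pow_mul_exp_neg_mul_sq (k : ℕ) {b : ℝ} (hb : 0 < b) :
    ∫⁻ R in Ioi (0 : ℝ), ENNReal.ofReal (R ^ k * Real.exp (-b * R ^ 2)) =
      ENNReal.ofReal (b ^ (-((k : ℝ) + 1) / 2) * (1 / 2 * Real.Gamma (((k : ℝ) + 1) / 2))) := by
  have hk : (-1 : ℝ) < k := by have : (0 : ℝ) ≤ k := k.cast_nonneg; linarith
  have h := integral_rpow_mul_exp_neg_mul_rpow (p := 2) two_pos hk hb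
  have hi := integrableOn_rpow_mul_exp_neg_mul_sq hb hk
  simp only [Real.rpow_natCast, Real.rpow_ofNat] at h hi
  rw [← ofReal_integral_eq_lintegral_ofReal hi, h, mul_assoc]
  refine (ae_restrict_iff' measurableSet_Ioi).2 (ae_of_all _ fun R hR => ?_)
  exact mul_nonneg (pow_nonneg (le_of_lt hR) _) (Real.exp_pos _).le

theorem measurable_indicator_ball_uncurry {V : Type*} [NormedAddCommGroup V] [MeasurableSpace V]
    [BorelSpace V] :
    Measurable fun q : ℝ × V => (Metric.ball (0 : V) q.1).indicator (1 : V → ℝ≥0∞) q.2 := by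
  have : (fun q : ℝ × V => (Metric.ball (0 : V) q.1).indicator (1 : V → ℝ≥0∞) q.2) =
      {q : ℝ × V | ‖q.2‖ < q.1}.indicator 1 := by
    ext q; simp [indicator]
  rw [this]
  exact measurable_one.indicator (measurableSet_lt (by fun_prop) (by fun_prop))

section Mixture

variable {V : Type*} [NormedAddCommGroup V] [InnerProductSpace ℝ V] [FiniteDimensional ℝ V]
  [MeasurableSpace V] [BorelSpace V]

/-- Applied with `ρ` the reduced second moment to get second moments, and with `ρ` Lebesgue to get
the squared means to be subtracted. -/
theorem lintegral_lintegral_ball_correlation (ρ : Measure V) [SFinite ρ] {b : ℝ} (hb : 0 < b) :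
    ∫⁻ R in Ioi (0 : ℝ), ENNReal.ofReal (R * Real.exp (-b * R ^ 2)) *
        ∫⁻ v, (∫⁻ z : V, (Metric.ball 0 R).indicator 1 (z + v) *
          (Metric.ball 0 R).indicator 1 z) ∂ρ =
      ∫⁻ θ : ℝ, ENNReal.ofReal (mixtureDensity (Module.finrank ℝ V) b θ) *
        ∫⁻ v, (∫⁻ z : V, gaussianBump (b * (1 + θ ^ 2) / 4) (z + v) *
          gaussianBump (b * (1 + θ ^ 2) / 4) z) ∂ρ := by
  have hB : Measurable fun q : ℝ × V => ∫⁻ z : V, (Metric.ball 0 q.1).indicator 1 (z + q.2) *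
      (Metric.ball 0 q.1).indicator (1 : V → ℝ≥0∞) z := by
    refine Measurable.lintegral_prod_right' (f := fun r : (ℝ × V) × V =>
      (Metric.ball 0 r.1.1).indicator 1 (r.2 + r.1.2) *
      (Metric.ball 0 r.1.1).indicator (1 : V → ℝ≥0∞) r.2) ?_
    exact (measurable_indicator_ball_uncurry.comp
      (show Measurable fun r : (ℝ × V) × V => (r.1.1, r.2 + r.1.2) by fun_prop)).mul
      (measurable_indicator_ball_uncurry.comp
      (show Measurable fun r : (ℝ × V) × V => (r.1.1, r.2) by fun_prop))
  have hG : Measurable fun q : ℝ × V => ∫⁻ z : V, gaussianBump (b * (1 + q.1 ^ 2) / 4) (z + q.2) *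
      gaussianBump (b * (1 + q.1 ^ 2) / 4) z := by
    refine Measurable.lintegral_prod_right' (f := fun r : (ℝ × V) × V =>
      gaussianBump (b * (1 + r.1.1 ^ 2) / 4) (r.2 + r.1.2) *
      gaussianBump (b * (1 + r.1.1 ^ 2) / 4) r.2) ?_
    unfold gaussianBump
    fun_prop
  have hmix : Measurable fun θ : ℝ =>
      ENNReal.ofReal (mixtureDensity (Module.finrank ℝ V) b θ) := by
    unfold mixtureDensity; fun_prop
  have hB' : Measurable (Function.uncurry fun (R : ℝ) (v : V) =>
      ENNReal.ofReal (R * Real.exp (-b * R ^ 2)) * ∫⁻ z : V, (Metric.ball 0 R).indicator 1 (z + v) *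
        (Metric.ball 0 R).indicator (1 : V → ℝ≥0∞) z) :=
    Measurable.mul (show Measurable fun q : ℝ × V =>
      ENNReal.ofReal (q.1 * Real.exp (-b * q.1 ^ 2)) by fun_prop) hB
  have hG' : Measurable (Function.uncurry fun (θ : ℝ) (v : V) =>
      ENNReal.ofReal (mixtureDensity (Module.finrank ℝ V) b θ) *
        ∫⁻ z : V, gaussianBump (b * (1 + θ ^ 2) / 4) (z + v) *
          gaussianBump (b * (1 + θ ^ 2) / 4) z) :=
    (hmix.comp measurable_fst).mul hG
  refine (lintegral_congr fun R => (lintegral_const_mul' _ _ ENNReal.ofReal_ne_top).symm).trans ?_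
  refine (lintegral_lintegral_swap hB'.aemeasurable).trans ?_
  refine (lintegral_congr fun v => lintegral_ball_correlation hb v).trans ?_
  refine (lintegral_lintegral_swap hG'.aemeasurable).symm.trans ?_
  exact lintegral_congr fun R => lintegral_const_mul' _ _ ENNReal.ofReal_ne_top

theorem lintegral_lintegral_mul_self {φ : V → ℝ≥0∞} (hφ : Measurable φ) :
    ∫⁻ v, (∫⁻ z : V, φ (z + v) * φ z) = (∫⁻ x, φ x) ^ 2 := by
  rw [lintegral_lintegral_swap (by fun_prop)]
  have : ∀ z : V, ∫⁻ v, φ (z + v) * φ z = (∫⁻ x, φ x) * φ z := by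
    intro z
    rw [lintegral_mul_const _ (by fun_prop), lintegral_add_left_eq_self]
  simp_rw [this]
  rw [lintegral_const_mul _ hφ, pow_two]

theorem lintegral_sq_volume_ball {b : ℝ} (hb : 0 < b) :
    ∫⁻ R in Ioi (0 : ℝ), ENNReal.ofReal (R * Real.exp (-b * R ^ 2)) *
        volume (Metric.ball (0 : V) R) ^ 2 =
      ∫⁻ θ : ℝ, ENNReal.ofReal (mixtureDensity (Module.finrank ℝ V) b θ) *
        (∫⁻ z : V, gaussianBump (b * (1 + θ ^ 2) / 4) z) ^ 2 := by
  have h := lintegral_lintegral_ball_correlation (volume : Measure V) hb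
  simp_rw [lintegral_lintegral_mul_self (measurable_one.indicator measurableSet_ball),
    lintegral_lintegral_mul_self (measurable_gaussianBump _),
    lintegral_indicator_one measurableSet_ball] at h
  exact h

theorem lintegral_sq_volume_ball_lt_top {b : ℝ} (hb : 0 < b) :
    ∫⁻ R in Ioi (0 : ℝ), ENNReal.ofReal (R * Real.exp (-b * R ^ 2)) *
        volume (Metric.ball (0 : V) R) ^ 2 < ∞ := by
  have h : ∀ R ∈ Ioi (0 : ℝ), ENNReal.ofReal (R * Real.exp (-b * R ^ 2)) *
      volume (Metric.ball (0 : V) R) ^ 2 = volume (Metric.ball (0 : V) 1) ^ 2 *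
      ENNReal.ofReal (R ^ (2 * Module.finrank ℝ V + 1) * Real.exp (-b * R ^ 2)) := by
    intro R hR
    have hR' : 0 ≤ R := le_of_lt hR
    rw [Measure.addHaar_ball_of_pos _ _ hR, mul_pow, ← ENNReal.ofReal_pow (by positivity), ← mul_assoc,
      ← ENNReal.ofReal_mul (by positivity), mul_comm]
    congr 2; ring
  rw [setLIntegral_congr_fun measurableSet_Ioi h, lintegral_const_mul _ (by fun_prop),
    lintegral_pow_mul_exp_neg_mul_sq _ hb]
  exact ENNReal.mul_lt_top (ENNReal.pow_lt_top measure_ball_lt_top) ENNReal.ofReal_lt_top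

end Mixture

/-! ### Averaged number variance and Gaussian variances. -/

namespace RandomMeasure

open LocFinMeasure

variable {n : ℕ} {μ : Measure (LocFinMeasure n)}

theorem lintegral_secondMoment_ball [SFinite μ] (hinv : IsInvariant μ) {b : ℝ} (hb : 0 < b) :
    ∫⁻ R in Ioi (0 : ℝ), ENNReal.ofReal (R * Real.exp (-b * R ^ 2)) *
        ∫⁻ p, p.1 (Metric.ball 0 R) ^ 2 ∂μ =
      ∫⁻ θ : ℝ, ENNReal.ofReal (mixtureDensity n b θ) *
        ∫⁻ p, (∫⁻ x, gaussianBump (b * (1 + θ ^ 2) / 4) x ∂p.1) ^ 2 ∂μ := by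
  obtain ⟨ρ, hρ, h⟩ := exists_reduced_secondMoment hinv
  have key := lintegral_lintegral_ball_correlation ρ hb
  have h1 : ∀ R : ℝ, ∫⁻ v, (∫⁻ z, (Metric.ball 0 R).indicator 1 (z + v) *
      (Metric.ball 0 R).indicator 1 z) ∂ρ = ∫⁻ p, p.1 (Metric.ball 0 R) ^ 2 ∂μ := by
    intro R
    have hm : Measurable ((Metric.ball (0 : EuclideanSpace ℝ (Fin n)) R).indicator
      (1 : EuclideanSpace ℝ (Fin n) → ℝ≥0∞)) := measurable_one.indicator measurableSet_ball
    rw [← h _ _ hm hm]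
    simp_rw [lintegral_indicator_one measurableSet_ball, pow_two]
  have h2 : ∀ t : ℝ, ∫⁻ v, (∫⁻ z, gaussianBump t (z + v) * gaussianBump t z) ∂ρ =
      ∫⁻ p, (∫⁻ x, gaussianBump t x ∂p.1) ^ 2 ∂μ := by
    intro t
    rw [← h _ _ (measurable_gaussianBump t) (measurable_gaussianBump t)]
    simp_rw [pow_two]
  simp_rw [h1, h2, finrank_euclideanSpace_fin] at key
  exact key

/-- The variance of the Gaussian linear statistic `p ↦ ∫ exp (-2t‖x‖²) dp(x)`, for `μ` of
intensity `m`. -/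
noncomputable def gaussianVariance (μ : Measure (LocFinMeasure n)) (m : ℝ≥0) (t : ℝ) : ℝ≥0∞ :=
  ∫⁻ p, (∫⁻ x, gaussianBump t x ∂p.1) ^ 2 ∂μ -
    (m * ∫⁻ x : EuclideanSpace ℝ (Fin n), gaussianBump t x) ^ 2

theorem lintegral_sq_ball_eq [IsProbabilityMeasure μ] (hsq : IsLocallySquareIntegrable μ)
    {m : ℝ≥0} (hm : ∀ f : EuclideanSpace ℝ (Fin n) → ℝ≥0∞, Measurable f →
      ∫⁻ p, ∫⁻ x, f x ∂p.1 ∂μ = m * ∫⁻ x, f x) (R : ℝ) :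
    ∫⁻ p, p.1 (Metric.ball 0 R) ^ 2 ∂μ = ENNReal.ofReal (numberVariance μ R) +
      (m * volume (Metric.ball (0 : EuclideanSpace ℝ (Fin n)) R)) ^ 2 := by
  have hX : Measurable fun p : LocFinMeasure n => p.1 (Metric.ball 0 R) :=
    measurable_apply measurableSet_ball
  have hmean : ∫⁻ p, p.1 (Metric.ball 0 R) ∂μ =
      m * volume (Metric.ball (0 : EuclideanSpace ℝ (Fin n)) R) := by
    have := hm _ (measurable_one.indicator (measurableSet_ball (x := 0) (ε := R)))
    simpa only [lintegral_indicator_one measurableSet_ball] using this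
  have hfin : ∫⁻ p, p.1 (Metric.ball 0 R) ∂μ ≠ ∞ := by
    rw [hmean]; exact ENNReal.mul_ne_top ENNReal.coe_ne_top measure_ball_lt_top.ne
  rw [← hmean, lintegral_sq_eq_evariance_add hX hfin]
  congr 1
  have hlt := hsq _ measurableSet_ball (Metric.isBounded_ball (x := 0) (r := R))
  rw [lintegral_sq_eq_evariance_add hX hfin] at hlt
  rw [numberVariance, variance, ENNReal.ofReal_toReal]
  · rfl
  · exact (ENNReal.add_lt_top.1 hlt).1.ne

/-- The mixture identity for squared means is subtracted from the one for second moments. The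
computation gives equality; only this direction is needed. -/
theorem lintegral_gaussianVariance_le [IsProbabilityMeasure μ] (hinv : IsInvariant μ)
    (hsq : IsLocallySquareIntegrable μ)
    {m : ℝ≥0} (hm : ∀ f : EuclideanSpace ℝ (Fin n) → ℝ≥0∞, Measurable f →
      ∫⁻ p, ∫⁻ x, f x ∂p.1 ∂μ = m * ∫⁻ x, f x) {b : ℝ} (hb : 0 < b) :
    ∫⁻ θ : ℝ, ENNReal.ofReal (mixtureDensity n b θ) *
        gaussianVariance μ m (b * (1 + θ ^ 2) / 4) ≤
      ∫⁻ R in Ioi (0 : ℝ), ENNReal.ofReal (R * Real.exp (-b * R ^ 2)) *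
        ENNReal.ofReal (numberVariance μ R) := by
  have hmix : Measurable fun θ : ℝ => ENNReal.ofReal (mixtureDensity n b θ) := by
    unfold mixtureDensity; fun_prop
  have hbump : Measurable fun θ : ℝ => ∫⁻ x : EuclideanSpace ℝ (Fin n),
      gaussianBump (b * (1 + θ ^ 2) / 4) x := by
    refine Measurable.lintegral_prod_right' (f := fun q : ℝ × EuclideanSpace ℝ (Fin n) =>
      gaussianBump (b * (1 + q.1 ^ 2) / 4) q.2) ?_
    unfold gaussianBump; fun_prop
  have hZ : ∫⁻ R in Ioi (0 : ℝ), ENNReal.ofReal (R * Real.exp (-b * R ^ 2)) *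
        (m * volume (Metric.ball (0 : EuclideanSpace ℝ (Fin n)) R)) ^ 2 =
      ∫⁻ θ : ℝ, ENNReal.ofReal (mixtureDensity n b θ) *
        (m * ∫⁻ x : EuclideanSpace ℝ (Fin n), gaussianBump (b * (1 + θ ^ 2) / 4) x) ^ 2 := by
    have h := lintegral_sq_volume_ball (V := EuclideanSpace ℝ (Fin n)) hb
    rw [finrank_euclideanSpace_fin] at h
    simp_rw [mul_pow, mul_left_comm _ ((m : ℝ≥0∞) ^ 2)]
    rw [lintegral_const_mul' _ _ (by finiteness), lintegral_const_mul' _ _ (by finiteness), h]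
  -- Finiteness here and Jensen in `hle` make the truncated subtractions in `ℝ≥0∞` genuine.
  have hZfin : ∫⁻ R in Ioi (0 : ℝ), ENNReal.ofReal (R * Real.exp (-b * R ^ 2)) *
        (m * volume (Metric.ball (0 : EuclideanSpace ℝ (Fin n)) R)) ^ 2 ≠ ∞ := by
    simp_rw [mul_pow, mul_left_comm _ ((m : ℝ≥0∞) ^ 2)]
    rw [lintegral_const_mul' _ _ (by finiteness)]
    exact ENNReal.mul_ne_top (by finiteness) (lintegral_sq_volume_ball_lt_top hb).ne
  have hle : ∀ θ : ℝ,
      (m * ∫⁻ x : EuclideanSpace ℝ (Fin n), gaussianBump (b * (1 + θ ^ 2) / 4) x) ^ 2 ≤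
        ∫⁻ p, (∫⁻ x, gaussianBump (b * (1 + θ ^ 2) / 4) x ∂p.1) ^ 2 ∂μ := by
    intro θ
    rw [← hm _ (measurable_gaussianBump _)]
    refine sq_lintegral_le_lintegral_sq (measurable_lintegral_const (measurable_gaussianBump _)) ?_
    rw [hm _ (measurable_gaussianBump _), lintegral_gaussianBump (by positivity)]
    finiteness
  unfold gaussianVariance
  simp_rw [ENNReal.mul_sub (fun _ _ => ENNReal.ofReal_ne_top)]
  rw [lintegral_sub' (by fun_prop) (hZ ▸ hZfin) (ae_of_all _ fun θ => by gcongr; exact hle θ),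
    ← lintegral_secondMoment_ball hinv hb, ← hZ]
  simp_rw [lintegral_sq_ball_eq hsq hm, mul_add]
  rw [lintegral_add_right', ENNReal.add_sub_cancel_right hZfin]
  have hV : Measurable fun R : ℝ => volume (Metric.ball (0 : EuclideanSpace ℝ (Fin n)) R) := by
    refine Monotone.measurable fun R S h => measure_mono (Metric.ball_subset_ball h)
  fun_prop

end RandomMeasure

/-! ### Scaling as `b → 0` and vanishing of Gaussian variances. -/

/-- Substitute `t = b(1 + θ²)/4`, injective on `θ > 0`. The Jacobian `bθ/2` is bounded using `θ ≤
√(1 + θ²)`, which leaves a pure power of `b` as constant. -/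
theorem lintegral_rpow_mul_le_lintegral_mixtureDensity (n : ℕ) {b : ℝ} (hb : 0 < b)
    (G : ℝ → ℝ≥0∞) :
    ∫⁻ t in Ioi (b / 4), ENNReal.ofReal (t ^ (((n : ℝ) - 3) / 2)) * G t ≤
      ENNReal.ofReal (Real.pi * 4 ^ ((3 - (n : ℝ)) / 2) * b ^ (((n : ℝ) + 1) / 2)) *
        ∫⁻ θ : ℝ, ENNReal.ofReal (mixtureDensity n b θ) * G (b * (1 + θ ^ 2) / 4) := by
  set f : ℝ → ℝ := fun θ => b * (1 + θ ^ 2) / 4 with hf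
  have hd : ∀ θ ∈ Ioi (0 : ℝ), HasDerivWithinAt f (b * θ / 2) (Ioi 0) θ := by
    intro θ _
    refine ((((hasDerivAt_pow 2 θ).const_add 1).const_mul b).div_const 4).hasDerivWithinAt.congr_deriv
      ?_
    simp; ring
  have hinj : InjOn f (Ioi 0) := by
    intro x hx y hy hxy
    simp only [hf] at hxy
    have h2 : x ^ 2 = y ^ 2 := by
      have := mul_left_cancel₀ hb.ne' ((div_left_inj' (by norm_num)).1 hxy)
      linarith
    exact (pow_left_inj₀ (le_of_lt hx) (le_of_lt hy) two_ne_zero).1 h2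
  have himg : Ioi (b / 4) ⊆ f '' Ioi 0 := by
    intro t ht
    have ht' : b / 4 < t := ht
    have h0 : 0 < 4 * t / b - 1 := by
      rw [sub_pos, lt_div_iff₀ hb]; linarith
    refine ⟨√(4 * t / b - 1), Real.sqrt_pos.2 h0, ?_⟩
    simp only [hf]
    rw [Real.sq_sqrt h0.le]; field_simp; ring
  calc _ ≤ ∫⁻ t in f '' Ioi 0, ENNReal.ofReal (t ^ (((n : ℝ) - 3) / 2)) * G t :=
        lintegral_mono_set himg
    _ = ∫⁻ θ in Ioi 0, ENNReal.ofReal |b * θ / 2| *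
          (ENNReal.ofReal (f θ ^ (((n : ℝ) - 3) / 2)) * G (f θ)) :=
        lintegral_image_eq_lintegral_abs_deriv_mul measurableSet_Ioi hd hinj _
    _ ≤ ∫⁻ θ in Ioi (0 : ℝ),
          ENNReal.ofReal (Real.pi * 4 ^ ((3 - (n : ℝ)) / 2) * b ^ (((n : ℝ) + 1) / 2)) *
          (ENNReal.ofReal (mixtureDensity n b θ) * G (f θ)) := by
        refine setLIntegral_mono' measurableSet_Ioi fun θ hθ => ?_
        have hθ' : 0 < θ := hθ
        rw [← mul_assoc, ← mul_assoc, ← ENNReal.ofReal_mul (abs_nonneg _),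
          ← ENNReal.ofReal_mul (by positivity)]
        gcongr ENNReal.ofReal ?_ * _
        rw [abs_of_pos (by positivity)]
        have hu : 0 < 1 + θ ^ 2 := by positivity
        have e1 : f θ ^ (((n : ℝ) - 3) / 2) = b ^ (((n : ℝ) - 3) / 2) *
            (1 + θ ^ 2) ^ (((n : ℝ) - 3) / 2) * 4 ^ ((3 - (n : ℝ)) / 2) := by
          simp only [hf]
          rw [Real.div_rpow (by positivity) (by norm_num), Real.mul_rpow hb.le hu.le,
            show (3 - (n : ℝ)) / 2 = -(((n : ℝ) - 3) / 2) by ring, Real.rpow_neg (by norm_num),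
            div_eq_mul_inv]
        have e2 : b ^ (((n : ℝ) + 1) / 2) = b ^ (((n : ℝ) - 3) / 2) * b ^ 2 := by
          rw [← Real.rpow_natCast b 2, ← Real.rpow_add hb]; congr 1; push_cast; ring
        have e3 : (1 + θ ^ 2) ^ ((n : ℝ) / 2) = (1 + θ ^ 2) ^ (((n : ℝ) - 3) / 2) *
            ((1 + θ ^ 2) * √(1 + θ ^ 2)) := by
          rw [Real.sqrt_eq_rpow]
          nth_rw 3 [← Real.rpow_one (1 + θ ^ 2)]
          rw [← Real.rpow_add hu, ← Real.rpow_add hu]; congr 1; ring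
        have e4 : θ ≤ √(1 + θ ^ 2) := Real.le_sqrt_of_sq_le (by linarith)
        unfold mixtureDensity
        rw [e1, e2, e3]
        calc _ = b / 2 * (b ^ (((n : ℝ) - 3) / 2) *
              (1 + θ ^ 2) ^ (((n : ℝ) - 3) / 2) * 4 ^ ((3 - (n : ℝ)) / 2)) * θ := by ring
          _ ≤ b / 2 * (b ^ (((n : ℝ) - 3) / 2) *
              (1 + θ ^ 2) ^ (((n : ℝ) - 3) / 2) * 4 ^ ((3 - (n : ℝ)) / 2)) * √(1 + θ ^ 2) := by
            gcongr
          _ = _ := by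
            field_simp
    _ ≤ ∫⁻ θ : ℝ,
          ENNReal.ofReal (Real.pi * 4 ^ ((3 - (n : ℝ)) / 2) * b ^ (((n : ℝ) + 1) / 2)) *
          (ENNReal.ofReal (mixtureDensity n b θ) * G (f θ)) := setLIntegral_le_lintegral _ _
    _ = _ := lintegral_const_mul' _ _ ENNReal.ofReal_ne_top

/-- Radii up to `R₀` contribute an amount bounded independently of `b`; the tail carries the small
factor `δ` and the scaling `b^(-(n+1)/2)`. -/
theorem lintegral_mul_exp_neg_mul_sq_le {n : ℕ} (hn : 1 ≤ n) {N : ℝ → ℝ} {K δ R₀ : ℝ} (hδ : 0 ≤ δ)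
    (hK : 0 ≤ K) (hR₀ : 0 ≤ R₀) (h1 : ∀ R ∈ Ioc 0 R₀, N R ≤ K)
    (h2 : ∀ R ∈ Ioi R₀, N R ≤ δ * R ^ (n - 1)) {b : ℝ} (hb : 0 < b) :
    ∫⁻ R in Ioi (0 : ℝ), ENNReal.ofReal (R * Real.exp (-b * R ^ 2)) * ENNReal.ofReal (N R) ≤
      ENNReal.ofReal (R₀ * K * R₀ + δ * (b ^ (-((n : ℝ) + 1) / 2) *
        (1 / 2 * Real.Gamma (((n : ℝ) + 1) / 2)))) := by
  rw [← Ioc_union_Ioi_eq_Ioi hR₀]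
  refine (lintegral_union_le _ _ _).trans ?_
  have hΓ : 0 < Real.Gamma (((n : ℝ) + 1) / 2) := Real.Gamma_pos_of_pos (by positivity)
  rw [ENNReal.ofReal_add (by positivity) (by positivity)]
  gcongr
  · calc _ ≤ ∫⁻ R in Ioc 0 R₀, ENNReal.ofReal (R₀ * K) := by
          refine setLIntegral_mono' measurableSet_Ioc fun R hR => ?_
          rw [ENNReal.ofReal_mul hR₀]
          gcongr
          · calc R * Real.exp (-b * R ^ 2) ≤ R₀ * 1 := by
                  gcongr
                  · exact hR.2
                  · rw [Real.exp_le_one_iff]; nlinarith [sq_nonneg R]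
              _ = R₀ := mul_one _
          · exact h1 R hR
      _ = _ := by
          rw [lintegral_const, Measure.restrict_apply_univ, Real.volume_Ioc, sub_zero,
            ← ENNReal.ofReal_mul (by positivity)]
  · calc _ ≤ ∫⁻ R in Ioi R₀, ENNReal.ofReal δ * ENNReal.ofReal (R ^ n * Real.exp (-b * R ^ 2)) := by
          refine setLIntegral_mono' measurableSet_Ioi fun R hR => ?_
          have hR' : 0 < R := hR₀.trans_lt hR
          rw [← ENNReal.ofReal_mul (by positivity), ← ENNReal.ofReal_mul hδ]
          refine ENNReal.ofReal_le_ofReal ?_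
          -- With `1 ≤ n` the natural subtraction is exact, so `R * R ^ (n - 1) = R ^ n`.
          obtain ⟨k, rfl⟩ : ∃ k, n = k + 1 := ⟨n - 1, by omega⟩
          calc R * Real.exp (-b * R ^ 2) * N R ≤ R * Real.exp (-b * R ^ 2) * (δ * R ^ k) := by
                gcongr; exact h2 R hR
            _ = _ := by ring
      _ ≤ ∫⁻ R in Ioi 0, ENNReal.ofReal δ * ENNReal.ofReal (R ^ n * Real.exp (-b * R ^ 2)) :=
          lintegral_mono_set (Ioi_subset_Ioi hR₀)
      _ = _ := by
          rw [lintegral_const_mul' _ _ ENNReal.ofReal_ne_top, lintegral_pow_mul_exp_neg_mul_sq n hb,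
            ← ENNReal.ofReal_mul hδ]

namespace RandomMeasure

open LocFinMeasure

variable {n : ℕ} {μ : Measure (LocFinMeasure n)}

theorem exists_numberVariance_le [IsProbabilityMeasure μ] (hinv : IsInvariant μ)
    (hsq : IsLocallySquareIntegrable μ) (R₀ : ℝ) :
    ∃ K : ℝ, 0 ≤ K ∧ ∀ R ≤ R₀, numberVariance μ R ≤ K := by
  obtain ⟨m, hm⟩ := exists_intensity_eq_smul_volume hinv hsq
  have hfin := hsq _ measurableSet_ball (Metric.isBounded_ball (x := 0) (r := R₀))
  refine ⟨_, ENNReal.toReal_nonneg (a := ∫⁻ p, p.1 (Metric.ball 0 R₀) ^ 2 ∂μ), fun R hR => ?_⟩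
  refine (ENNReal.ofReal_le_iff_le_toReal hfin.ne).1 ?_
  calc ENNReal.ofReal (numberVariance μ R) ≤ ∫⁻ p, p.1 (Metric.ball 0 R) ^ 2 ∂μ := by
        rw [lintegral_sq_ball_eq hsq hm]; exact le_self_add
    _ ≤ _ := lintegral_mono fun p => by gcongr

/-- The power `b^((n+1)/2)` from the substitution cancels the growth of the tail and kills the
bounded part. Letting `b → 0` and then `δ → 0` leaves zero. -/
theorem lintegral_gaussianVariance_eq_zero [IsProbabilityMeasure μ] (hn : 1 ≤ n)
    (hinv : IsInvariant μ) (hsq : IsLocallySquareIntegrable μ)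
    {m : ℝ≥0} (hm : ∀ f : EuclideanSpace ℝ (Fin n) → ℝ≥0∞, Measurable f →
      ∫⁻ p, ∫⁻ x, f x ∂p.1 ∂μ = m * ∫⁻ x, f x)
    (hlim : ∀ δ > 0, ∀ᶠ R in atTop, numberVariance μ R ≤ δ * R ^ (n - 1)) {a : ℝ} (ha : 0 < a) :
    ∫⁻ t in Ioi a, ENNReal.ofReal (t ^ (((n : ℝ) - 3) / 2)) * gaussianVariance μ m t = 0 := by
  set I := ∫⁻ t in Ioi a, ENNReal.ofReal (t ^ (((n : ℝ) - 3) / 2)) * gaussianVariance μ m t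
  set s : ℝ := ((n : ℝ) + 1) / 2 with hs
  have hs0 : 0 < s := by positivity
  set c : ℝ := Real.pi * 4 ^ ((3 - (n : ℝ)) / 2) with hc
  have hc0 : 0 < c := by positivity
  set Γ : ℝ := 1 / 2 * Real.Gamma s with hΓ
  have hΓ0 : 0 < Γ := mul_pos (by norm_num) (Real.Gamma_pos_of_pos hs0)
  have step : ∀ δ > 0, I ≤ ENNReal.ofReal (c * Γ * δ) := by
    intro δ hδ
    obtain ⟨R₀, hR₀0, hR₀⟩ := ((eventually_ge_atTop (0 : ℝ)).and
      (eventually_atTop.2 ((eventually_atTop.1 (hlim δ hδ)).imp fun R₀ h R hR =>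
        fun S (hS : R ≤ S) => h S (hR.trans hS)))).exists
    obtain ⟨K, hK0, hK⟩ := exists_numberVariance_le hinv hsq R₀
    have hbd : ∀ b ∈ Ioo 0 a, I ≤ ENNReal.ofReal (c * (R₀ * K * R₀) * b ^ s + c * Γ * δ) := by
      intro b hb
      have hb0 : 0 < b := hb.1
      calc I ≤ ∫⁻ t in Ioi (b / 4), ENNReal.ofReal (t ^ (((n : ℝ) - 3) / 2)) *
              gaussianVariance μ m t := lintegral_mono_set (Ioi_subset_Ioi (by linarith [hb.2]))
        _ ≤ _ := lintegral_rpow_mul_le_lintegral_mixtureDensity n hb0 _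
        _ ≤ ENNReal.ofReal (c * b ^ s) * ENNReal.ofReal (R₀ * K * R₀ + δ * (b ^ (-s) * Γ)) := by
            gcongr
            refine (lintegral_gaussianVariance_le hinv hsq hm hb0).trans ?_
            have := lintegral_mul_exp_neg_mul_sq_le hn hδ.le hK0 hR₀0
              (fun R hR => hK R hR.2) (fun R hR => hR₀ R (le_of_lt hR)) hb0
            rwa [neg_div] at this
        _ = _ := by
            rw [← ENNReal.ofReal_mul (by positivity)]
            congr 1
            have : b ^ s * b ^ (-s) = 1 := by
              rw [← Real.rpow_add hb0, add_neg_cancel, Real.rpow_zero]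
            linear_combination (c * δ * Γ) * this
    have ht : Tendsto (fun b : ℝ => ENNReal.ofReal (c * (R₀ * K * R₀) * b ^ s + c * Γ * δ))
        (nhdsWithin 0 (Ioi 0)) (nhds (ENNReal.ofReal (c * Γ * δ))) := by
      refine ENNReal.tendsto_ofReal (Tendsto.mono_left ?_ nhdsWithin_le_nhds)
      have := (((Real.continuousAt_rpow_const 0 s (Or.inr hs0.le)).tendsto).const_mul
        (c * (R₀ * K * R₀))).add_const (c * Γ * δ)
      simpa [Real.zero_rpow hs0.ne'] using this
    exact ge_of_tendsto ht (Filter.mem_of_superset (Ioo_mem_nhdsGT ha) hbd)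
  have ht : Tendsto (fun δ : ℝ => ENNReal.ofReal (c * Γ * δ))
      (nhdsWithin 0 (Ioi 0)) (nhds 0) := by
    have h0 : Tendsto (fun δ : ℝ => c * Γ * δ) (nhdsWithin 0 (Ioi 0)) (nhds (c * Γ * 0)) :=
      (tendsto_id.mono_left nhdsWithin_le_nhds).const_mul _
    simpa using ENNReal.tendsto_ofReal h0
  exact le_antisymm (ge_of_tendsto ht (eventually_nhdsWithin_of_forall step)) zero_le

theorem measurable_gaussianVariance [SFinite μ] {m : ℝ≥0} :
    Measurable (gaussianVariance μ m) := by
  have h1 : Measurable fun q : ℝ × LocFinMeasure n => ∫⁻ x, gaussianBump q.1 x ∂q.2.1 :=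
    measurable_lintegral measurable_gaussianBump_uncurry
  have h2 : Measurable fun t : ℝ => ∫⁻ x : EuclideanSpace ℝ (Fin n), gaussianBump t x :=
    Measurable.lintegral_prod_right' (f := fun q : ℝ × EuclideanSpace ℝ (Fin n) =>
      gaussianBump q.1 q.2) measurable_gaussianBump_uncurry
  exact (h1.pow_const 2).lintegral_prod_right'.sub ((h2.const_mul _).pow_const 2)

theorem exists_gt_gaussianVariance_eq_zero [IsProbabilityMeasure μ] (hn : 1 ≤ n)
    (hinv : IsInvariant μ) (hsq : IsLocallySquareIntegrable μ)
    {m : ℝ≥0} (hm : ∀ f : EuclideanSpace ℝ (Fin n) → ℝ≥0∞, Measurable f →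
      ∫⁻ p, ∫⁻ x, f x ∂p.1 ∂μ = m * ∫⁻ x, f x)
    (hlim : ∀ δ > 0, ∀ᶠ R in atTop, numberVariance μ R ≤ δ * R ^ (n - 1)) {a : ℝ} (ha : 0 < a) :
    ∃ t > a, gaussianVariance μ m t = 0 := by
  have h := lintegral_gaussianVariance_eq_zero hn hinv hsq hm hlim ha
  have hmeas : Measurable fun t : ℝ =>
      ENNReal.ofReal (t ^ (((n : ℝ) - 3) / 2)) * gaussianVariance μ m t :=
    Measurable.mul (by fun_prop) measurable_gaussianVariance
  rw [lintegral_eq_zero_iff hmeas] at h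
  have : (ae (volume.restrict (Ioi a))).NeBot := by
    rw [ae_neBot, Ne, Measure.restrict_eq_zero]; simp
  obtain ⟨t, ht, hta⟩ := (h.and (ae_restrict_mem measurableSet_Ioi)).exists
  refine ⟨t, hta, ?_⟩
  rcases mul_eq_zero.1 ht with h0 | h0
  · exact absurd h0 (ENNReal.ofReal_pos.2 (Real.rpow_pos_of_pos (ha.trans hta) _)).ne'
  · exact h0

end RandomMeasure

/-! ### Gaussians as an approximate identity. -/

section Approximation

variable {V : Type*} [NormedAddCommGroup V] [InnerProductSpace ℝ V] [FiniteDimensional ℝ V]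
  [MeasurableSpace V] [BorelSpace V]

/-- Outside `U` one has `‖y - x‖ ≥ r`. Half of the exponent gives `exp (-r²t)`; the other half is a
wider Gaussian, whose mass is larger by the factor `2^(d/2)`, `d` being the dimension. -/
theorem lintegral_gaussianBump_le {U : Set V} (hU : MeasurableSet U) {y : V} {r t : ℝ}
    (hr : 0 ≤ r) (hrU : Metric.ball y r ⊆ U) (ht : 0 < t) :
    ∫⁻ x : V, gaussianBump t x ≤ (∫⁻ x in U, gaussianBump t (y - x)) +
      ENNReal.ofReal (2 ^ (Module.finrank ℝ V / 2 : ℝ) * Real.exp (-(r ^ 2) * t)) *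
        ∫⁻ x : V, gaussianBump t x := by
  have hhalf : ∫⁻ x : V, gaussianBump (t / 2) x =
      ENNReal.ofReal (2 ^ (Module.finrank ℝ V / 2 : ℝ)) * ∫⁻ x : V, gaussianBump t x := by
    rw [lintegral_gaussianBump (by positivity), lintegral_gaussianBump ht,
      ← ENNReal.ofReal_mul (by positivity), ← Real.mul_rpow (by positivity) (by positivity)]
    congr 2; field_simp
  conv_lhs => rw [← lintegral_sub_left_eq_self _ y, ← lintegral_add_compl _ hU]
  gcongr
  calc ∫⁻ x in Uᶜ, gaussianBump t (y - x)
      ≤ ∫⁻ x in Uᶜ, ENNReal.ofReal (Real.exp (-(r ^ 2) * t)) * gaussianBump (t / 2) (y - x) := by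
        refine setLIntegral_mono' hU.compl fun x hx => ?_
        have hxr : r ≤ ‖y - x‖ := by
          by_contra h
          exact hx (hrU (by rw [Metric.mem_ball, dist_comm, dist_eq_norm]; exact not_le.1 h))
        unfold gaussianBump
        rw [← ENNReal.ofReal_mul (Real.exp_pos _).le, ← Real.exp_add]
        refine ENNReal.ofReal_le_ofReal (Real.exp_le_exp.2 ?_)
        have : r ^ 2 ≤ ‖y - x‖ ^ 2 := by gcongr
        nlinarith
    _ ≤ ∫⁻ x, ENNReal.ofReal (Real.exp (-(r ^ 2) * t)) * gaussianBump (t / 2) (y - x) :=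
        setLIntegral_le_lintegral _ _
    _ = _ := by
        rw [lintegral_const_mul' _ _ ENNReal.ofReal_ne_top, lintegral_sub_left_eq_self, hhalf,
          ← mul_assoc, ← ENNReal.ofReal_mul (by positivity), mul_comm (Real.exp _)]

theorem one_le_liminf_gaussianBump {U : Set V} (hU : IsOpen U) {y : V} (hy : y ∈ U)
    {t : ℕ → ℝ} (ht0 : ∀ j, 0 < t j) (ht : Tendsto t atTop atTop) :
    1 ≤ liminf (fun j => (∫⁻ x : V, gaussianBump (t j) x)⁻¹ *
      ∫⁻ x in U, gaussianBump (t j) (y - x)) atTop := by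
  obtain ⟨r, hr, hrU⟩ := Metric.isOpen_iff.1 hU y hy
  set ε : ℕ → ℝ≥0∞ := fun j =>
    ENNReal.ofReal (2 ^ (Module.finrank ℝ V / 2 : ℝ) * Real.exp (-(r ^ 2) * t j)) with hε
  have hε0 : Tendsto (fun j => 1 - ε j) atTop (nhds 1) := by
    have h1 : Tendsto (fun j => Real.exp (-(r ^ 2) * t j)) atTop (nhds 0) :=
      Real.tendsto_exp_atBot.comp (ht.const_mul_atTop_of_neg (by nlinarith))
    have h2 : Tendsto ε atTop (nhds 0) := by
      have := ENNReal.tendsto_ofReal (h1.const_mul (2 ^ (Module.finrank ℝ V / 2 : ℝ)))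
      simpa [hε] using this
    have h3 := ENNReal.Tendsto.sub (tendsto_const_nhds (x := (1 : ℝ≥0∞))) h2
      (Or.inl ENNReal.one_ne_top)
    simpa using h3
  rw [← hε0.liminf_eq]
  refine liminf_le_liminf (Eventually.of_forall fun j => ?_)
  have hI := lintegral_gaussianBump (V := V) (ht0 j)
  have hpos : 0 < (Real.pi / (2 * t j)) ^ (Module.finrank ℝ V / 2 : ℝ) := by
    have := ht0 j; positivity
  have hI0 : ∫⁻ x : V, gaussianBump (t j) x ≠ 0 := by
    rw [hI]; exact (ENNReal.ofReal_pos.2 hpos).ne'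
  have hIt : ∫⁻ x : V, gaussianBump (t j) x ≠ ∞ := by rw [hI]; exact ENNReal.ofReal_ne_top
  have h := lintegral_gaussianBump_le hU.measurableSet hr.le hrU (ht0 j)
  rw [tsub_le_iff_right]
  have h' := mul_le_mul_right h (∫⁻ x : V, gaussianBump (t j) x)⁻¹
  rw [ENNReal.inv_mul_cancel hI0 hIt, mul_add, mul_left_comm _ (ENNReal.ofReal _),
    ENNReal.inv_mul_cancel hI0 hIt, mul_one] at h'
  exact h'

end Approximation

/-! ### Rigidity: vanishing Gaussian variances force a multiple of Lebesgue measure. -/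

namespace RandomMeasure

open LocFinMeasure

variable {n : ℕ} {μ : Measure (LocFinMeasure n)}

theorem ae_lintegral_gaussianBump_sub_eq [IsProbabilityMeasure μ] (hinv : IsInvariant μ)
    {m : ℝ≥0} (hm : ∀ f : EuclideanSpace ℝ (Fin n) → ℝ≥0∞, Measurable f →
      ∫⁻ p, ∫⁻ x, f x ∂p.1 ∂μ = m * ∫⁻ x, f x) {t : ℝ} (ht : 0 < t)
    (hvar : gaussianVariance μ m t = 0) (x : EuclideanSpace ℝ (Fin n)) :
    ∀ᵐ p ∂μ, ∫⁻ y, gaussianBump t (y - x) ∂p.1 =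
      m * ∫⁻ z : EuclideanSpace ℝ (Fin n), gaussianBump t z := by
  have hmeas : Measurable fun p : LocFinMeasure n => ∫⁻ y, gaussianBump t y ∂p.1 :=
    measurable_lintegral_const (measurable_gaussianBump t)
  have hmean := hm _ (measurable_gaussianBump t)
  have h0 : ∀ᵐ p ∂μ, ∫⁻ y, gaussianBump t y ∂p.1 =
      m * ∫⁻ z : EuclideanSpace ℝ (Fin n), gaussianBump t z := by
    rw [← hmean]
    refine ae_eq_lintegral_of_lintegral_sq_le hmeas ?_ ?_
    · rw [hmean, lintegral_gaussianBump ht]; finiteness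
    · rw [hmean]; exact tsub_eq_zero_iff_le.1 hvar
  rw [← hinv (-x)] at h0
  filter_upwards [ae_of_ae_map (measurable_translate (-x)).aemeasurable h0] with p hp
  rw [LocFinMeasure.lintegral_translate _ _ (measurable_gaussianBump t)] at hp
  simpa only [neg_add_eq_sub] using hp

/-- The exceptional null set for a single centre `x` depends on `x`; Fubini gives almost every `p`
the identity for almost every `x`, which suffices for integration over `U`. -/
theorem ae_lintegral_lintegral_gaussianBump_eq [IsProbabilityMeasure μ] (hinv : IsInvariant μ)
    {m : ℝ≥0} (hm : ∀ f : EuclideanSpace ℝ (Fin n) → ℝ≥0∞, Measurable f →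
      ∫⁻ p, ∫⁻ x, f x ∂p.1 ∂μ = m * ∫⁻ x, f x) {t : ℝ} (ht : 0 < t)
    (hvar : gaussianVariance μ m t = 0) (U : Set (EuclideanSpace ℝ (Fin n))) :
    ∀ᵐ p ∂μ, ∫⁻ y, (∫⁻ x in U, gaussianBump t (y - x)) ∂p.1 =
      m * (∫⁻ z : EuclideanSpace ℝ (Fin n), gaussianBump t z) * volume U := by
  have hG : Measurable fun q : EuclideanSpace ℝ (Fin n) × EuclideanSpace ℝ (Fin n) =>
      gaussianBump t (q.2 - q.1) := (measurable_gaussianBump t).comp (by fun_prop)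
  have hmeas : Measurable fun q : EuclideanSpace ℝ (Fin n) × LocFinMeasure n =>
      ∫⁻ y, gaussianBump t (y - q.1) ∂q.2.1 :=
    measurable_lintegral (f := fun x y => gaussianBump t (y - x)) hG
  have hae : ∀ᵐ p ∂μ, ∀ᵐ x ∂(volume : Measure (EuclideanSpace ℝ (Fin n))),
      ∫⁻ y, gaussianBump t (y - x) ∂p.1 =
        m * ∫⁻ z : EuclideanSpace ℝ (Fin n), gaussianBump t z :=
    (Measure.ae_ae_comm (p := fun (x : EuclideanSpace ℝ (Fin n)) (p : LocFinMeasure n) =>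
      ∫⁻ y, gaussianBump t (y - x) ∂p.1 =
        m * ∫⁻ z : EuclideanSpace ℝ (Fin n), gaussianBump t z)
      (measurableSet_eq_fun hmeas measurable_const)).1
      (ae_of_all _ (ae_lintegral_gaussianBump_sub_eq hinv hm ht hvar))
  filter_upwards [hae] with p hp
  rw [lintegral_lintegral_swap (f := fun y x => gaussianBump t (y - x))
      (hG.comp measurable_swap).aemeasurable,
    lintegral_congr_ae (ae_restrict_of_ae hp), lintegral_const, Measure.restrict_apply_univ]

/-- Fatou's lemma along `t → ∞` yields only `p(U) ≤ m vol(U)`, since the approximate identity is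
bounded below on the open set `U`. Both sides have the same finite mean, which upgrades this to
equality almost surely. -/
theorem ae_apply_eq_of_isOpen [IsProbabilityMeasure μ] (hinv : IsInvariant μ)
    {m : ℝ≥0} (hm : ∀ f : EuclideanSpace ℝ (Fin n) → ℝ≥0∞, Measurable f →
      ∫⁻ p, ∫⁻ x, f x ∂p.1 ∂μ = m * ∫⁻ x, f x)
    (hvar : ∀ a > 0, ∃ t > a, gaussianVariance μ m t = 0)
    {U : Set (EuclideanSpace ℝ (Fin n))} (hU : IsOpen U) (hUfin : volume U ≠ ∞) :
    ∀ᵐ p ∂μ, p.1 U = m * volume U := by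
  have hvar' : ∀ j : ℕ, ∃ t > (j : ℝ), 0 < t ∧ gaussianVariance μ m t = 0 := by
    intro j
    obtain ⟨t, ht, h⟩ := hvar (j + 1) (by positivity)
    have : (0 : ℝ) ≤ j := j.cast_nonneg
    exact ⟨t, by linarith, by linarith, h⟩
  choose t htj ht0 htvar using hvar'
  have ht : Tendsto t atTop atTop :=
    tendsto_atTop_mono (fun j => (htj j).le) tendsto_natCast_atTop_atTop
  have hle : ∀ᵐ p ∂μ, p.1 U ≤ m * volume U := by
    filter_upwards [ae_all_iff.2 fun j =>
      ae_lintegral_lintegral_gaussianBump_eq hinv hm (ht0 j) (htvar j) U] with p hp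
    have hconv : ∀ j, Measurable fun y => ∫⁻ x in U, gaussianBump (t j) (y - x) := fun j =>
      Measurable.lintegral_prod_right' (f := fun q : EuclideanSpace ℝ (Fin n) ×
        EuclideanSpace ℝ (Fin n) => gaussianBump (t j) (q.1 - q.2))
        ((measurable_gaussianBump _).comp (by fun_prop))
    have hint : ∀ j, ∫⁻ y, (∫⁻ x : EuclideanSpace ℝ (Fin n), gaussianBump (t j) x)⁻¹ *
        (∫⁻ x in U, gaussianBump (t j) (y - x)) ∂p.1 = m * volume U := by
      intro j
      have hI := lintegral_gaussianBump (V := EuclideanSpace ℝ (Fin n)) (ht0 j)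
      have hI0 : ∫⁻ x : EuclideanSpace ℝ (Fin n), gaussianBump (t j) x ≠ 0 := by
        rw [hI]
        exact (ENNReal.ofReal_pos.2 (Real.rpow_pos_of_pos
          (div_pos Real.pi_pos (mul_pos two_pos (ht0 j))) _)).ne'
      have hIt : ∫⁻ x : EuclideanSpace ℝ (Fin n), gaussianBump (t j) x ≠ ∞ := by
        rw [hI]; exact ENNReal.ofReal_ne_top
      rw [lintegral_const_mul _ (hconv j), hp j, mul_comm (m : ℝ≥0∞), mul_assoc, ← mul_assoc,
        ENNReal.inv_mul_cancel hI0 hIt, one_mul]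
    calc p.1 U = ∫⁻ y in U, 1 ∂p.1 := by simp
      _ ≤ ∫⁻ y in U, liminf (fun j => (∫⁻ x : EuclideanSpace ℝ (Fin n), gaussianBump (t j) x)⁻¹ *
            ∫⁻ x in U, gaussianBump (t j) (y - x)) atTop ∂p.1 :=
          setLIntegral_mono' hU.measurableSet fun y hy => one_le_liminf_gaussianBump hU hy ht0 ht
      _ ≤ ∫⁻ y, liminf (fun j => (∫⁻ x : EuclideanSpace ℝ (Fin n), gaussianBump (t j) x)⁻¹ *
            ∫⁻ x in U, gaussianBump (t j) (y - x)) atTop ∂p.1 := setLIntegral_le_lintegral _ _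
      _ ≤ liminf (fun j => ∫⁻ y, (∫⁻ x : EuclideanSpace ℝ (Fin n), gaussianBump (t j) x)⁻¹ *
            (∫⁻ x in U, gaussianBump (t j) (y - x)) ∂p.1) atTop :=
          lintegral_liminf_le fun j => (hconv j).const_mul _
      _ = m * volume U := by simp_rw [hint]; exact liminf_const _
  have hmean : ∫⁻ p, p.1 U ∂μ = m * volume U := by
    have := hm _ (measurable_one.indicator hU.measurableSet)
    simpa only [lintegral_indicator_one hU.measurableSet] using this
  refine ae_eq_of_ae_le_of_lintegral_le hle ?_ aemeasurable_const ?_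
  · rw [hmean]; exact ENNReal.mul_ne_top ENNReal.coe_ne_top hUfin
  · rw [hmean, lintegral_const, measure_univ, mul_one]

/-- A single null set must serve all Borel sets: a countable π-system of open sets generates the
σ-algebra, and intersecting with balls `B N` keeps volumes finite. -/
theorem ae_eq_smul_volume_of_isOpen {m : ℝ≥0}
    (h : ∀ U : Set (EuclideanSpace ℝ (Fin n)), IsOpen U → volume U ≠ ∞ →
      ∀ᵐ p ∂μ, p.1 U = m * volume U) :
    ∀ᵐ p ∂μ, p.1 = m • (volume : Measure (EuclideanSpace ℝ (Fin n))) := by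
  set b := TopologicalSpace.countableBasis (EuclideanSpace ℝ (Fin n))
  have hb := TopologicalSpace.isBasis_countableBasis (EuclideanSpace ℝ (Fin n))
  set C := (fun f => ⋂₀ f) '' {f : Set (Set (EuclideanSpace ℝ (Fin n))) | f.Finite ∧ f ⊆ b}
  have hCbasis : TopologicalSpace.IsTopologicalBasis C :=
    TopologicalSpace.isTopologicalBasis_of_subbasis hb.eq_generateFrom
  have hCc : C.Countable :=
    (countable_ofPred_finite_subset (TopologicalSpace.countable_countableBasis _)).image _
  have hCpi : IsPiSystem C := by
    rintro _ ⟨f, ⟨hf, hfb⟩, rfl⟩ _ ⟨g, ⟨hg, hgb⟩, rfl⟩ -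
    exact ⟨f ∪ g, ⟨hf.union hg, union_subset hfb hgb⟩, sInter_union f g⟩
  have hgen : (inferInstance : MeasurableSpace (EuclideanSpace ℝ (Fin n))) =
      MeasurableSpace.generateFrom C := by
    rw [← hCbasis.borel_eq_generateFrom]
    exact BorelSpace.measurable_eq
  set B : ℕ → Set (EuclideanSpace ℝ (Fin n)) := fun N => Metric.ball 0 N
  have hBU : ⋃ N, B N = univ := Metric.iUnion_ball_nat 0
  have hball : ∀ᵐ p ∂μ, ∀ N : ℕ, p.1 (B N) = m * volume (B N) :=
    ae_all_iff.2 fun N => h _ Metric.isOpen_ball measure_ball_lt_top.ne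
  have hC : ∀ᵐ p ∂μ, ∀ U ∈ C, ∀ N : ℕ, p.1 (U ∩ B N) = m * volume (U ∩ B N) := by
    refine (ae_ball_iff hCc).2 fun U hU => ae_all_iff.2 fun N => h _ ?_ ?_
    · exact (hCbasis.isOpen hU).inter Metric.isOpen_ball
    · exact ((measure_mono inter_subset_right).trans_lt measure_ball_lt_top).ne
  filter_upwards [hball, hC] with p hp1 hp2
  refine (Measure.ext_iff_of_iUnion_eq_univ hBU).2 fun N => ?_
  have : IsFiniteMeasure (p.1.restrict (B N)) :=
    ⟨by rw [Measure.restrict_apply_univ]; exact measure_ball_lt_top⟩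
  refine ext_of_generate_finite C hgen hCpi (fun U hU => ?_) ?_
  · have hUm : MeasurableSet U := (hCbasis.isOpen hU).measurableSet
    rw [Measure.restrict_apply hUm, Measure.restrict_apply hUm, hp2 U hU N]
    rfl
  · rw [Measure.restrict_apply_univ, Measure.restrict_apply_univ, hp1 N]
    rfl

theorem isDeterministicLebesgue_of_eventually_le [IsProbabilityMeasure μ] (hn : 1 ≤ n)
    (hinv : IsInvariant μ) (hsq : IsLocallySquareIntegrable μ)
    (hlim : ∀ δ > 0, ∀ᶠ R in atTop, numberVariance μ R ≤ δ * R ^ (n - 1)) :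
    IsDeterministicLebesgue μ := by
  obtain ⟨m, hm⟩ := exists_intensity_eq_smul_volume hinv hsq
  exact ⟨m, ae_eq_smul_volume_of_isOpen fun U hU hUfin => ae_apply_eq_of_isOpen hinv hm
    (fun a ha => exists_gt_gaussianVariance_eq_zero hn hinv hsq hm hlim ha) hU hUfin⟩

end RandomMeasure

theorem theorem1p1 (n : ℕ) (hn : 1 ≤ n) (μ : Measure (LocFinMeasure n)) [IsProbabilityMeasure μ]
    (hinv : RandomMeasure.IsInvariant μ)
    (hsq : RandomMeasure.IsLocallySquareIntegrable μ)
    (hne : ¬ RandomMeasure.IsDeterministicLebesgue μ) :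
    0 < limsup (fun R : ℝ =>
      ((RandomMeasure.numberVariance μ R / RandomMeasure.sphereVolume n R : ℝ) : EReal)) atTop := by
  by_contra hle
  refine hne (RandomMeasure.isDeterministicLebesgue_of_eventually_le hn hinv hsq fun δ hδ => ?_)
  have : NeZero n := ⟨by omega⟩
  set S := (volume : Measure (EuclideanSpace ℝ (Fin n))).toSphere.real univ
  have hS : 0 < S := by
    rw [show S = _ from Measure.toSphere_real_apply_univ _, finrank_euclideanSpace_fin]
    exact mul_pos (by exact_mod_cast hn)
      (ENNReal.toReal_pos (Metric.measure_ball_pos volume _ one_pos).ne' measure_ball_lt_top.ne)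
  -- The level `δ / S` absorbs the area `S` of the unit sphere contained in `sphereVolume`.
  have hlt : limsup (fun R : ℝ => ((RandomMeasure.numberVariance μ R /
      RandomMeasure.sphereVolume n R : ℝ) : EReal)) atTop < ((δ / S : ℝ) : EReal) :=
    (not_lt.1 hle).trans_lt (by exact_mod_cast div_pos hδ hS)
  filter_upwards [eventually_lt_of_limsup_lt hlt, eventually_gt_atTop 0] with R hR hR0
  have hR' : RandomMeasure.numberVariance μ R / (R ^ (n - 1) * S) < δ / S := by
    exact_mod_cast hR
  rw [div_lt_iff₀ (by positivity)] at hR'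
  refine hR'.le.trans_eq ?_
  field_simp
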